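/- Let $\Gamma$ be a connected compact metric graph, i.e. $\Gamma$ has a finite vertex set $\mathcal V$, a finite nonempty edge set $\mathcal E$ (loops and multiple edges are allowed) and edge lengths $L(e)\in(0,\infty)$; each edge $e$ is identified with $[0,L(e)]$, its end points $0$ and $L(e)$ being glued to the vertices $o(e)$ and $t(e)$. Let $q=(q_e)_{e\in\mathcal E}\in L^\infty(\Gamma)$ be real-valued, and let $\alpha_v\in\mathbb R$ for each $v\in\mathcal V$. Let $H$ be the Schrödinger operator in the complex Hilbert space $L^2(\Gamma)=\bigoplus_{e}L^2(0,L(e))$ with $\delta$ coupling conditions of strength $\alpha_v$ at all vertices $v$, that is, $(Hf)_e=-f_e''+q_ef_e$ for $e\in\mathcal E$, where the domain of $H$ consists of all $f\in\bigoplus_e H^2(0,L(e))$ such that at every vertex $v$ the boundary values of $f$ at all edge ends incident to $v$ have one common value $f(v)$, and the sum over these edge ends of the derivatives of $f$, taken in the direction pointing out of $v$ into the edge, equals $\alpha_v f(v)$ (a loop at $v$ contributes both of its ends). Then $H$ has a lowest eigenvalue $\lambda_1(H)$, and the eigenspace $\ker(H-\lambda_1(H))$ is one-dimensional. Moreover,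 every eigenfunction of $H$ corresponding to $\lambda_1(H)$ is (represented by) a continuous function on $\Gamma$ which does not have any zero in $\Gamma$, and there is such an eigenfunction which is strictly positive on all of $\Gamma$. -/

import Mathlib

open MeasureTheory Set

namespace QuantumGraph

/-! ### Compact metric graphs -/

/-- A compact metric graph with (finite) vertex set `V` and (finite) edge set `E`. Every edge `e` is
parametrised by `[0, L e]`, with `0` at the vertex `o e` and `L e` at the vertex `t e`. Loops and
multiple edges are allowed. -/
structure CompactMetricGraph (V E : Type*) [Fintype V] [Fintype E] where
  o : E → V
  t : E → V
  L : E → ℝ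
  L_pos : ∀ e, 0 < L e

namespace CompactMetricGraph

variable {V E : Type*} [Fintype V] [Fintype E] (Γ : CompactMetricGraph V E)

/-- The identifications of the end points of the intervals `[0, L e]` with the vertices. -/
inductive Glue : V ⊕ (Σ e : E, Icc (0 : ℝ) (Γ.L e)) → V ⊕ (Σ e : E, Icc (0 : ℝ) (Γ.L e)) → Prop
  | origin (e : E) : Glue (Sum.inr ⟨e, 0, left_mem_Icc.2 (Γ.L_pos e).le⟩) (Sum.inl (Γ.o e))
  | terminus (e : E) :
      Glue (Sum.inr ⟨e, Γ.L e, right_mem_Icc.2 (Γ.L_pos e).le⟩) (Sum.inl (Γ.t e))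

/-- The points of the metric graph `Γ`: the one-dimensional complex obtained from the vertices and
the intervals `[0, L e]` by gluing. -/
def Space : Type _ := Quot Γ.Glue

/-- The quotient topology, where the vertex set is discrete. -/
instance : TopologicalSpace Γ.Space :=
  letI : TopologicalSpace V := ⊥
  inferInstanceAs (TopologicalSpace (Quot Γ.Glue))

/-- The point of `Γ` with coordinate `x` on the edge `e`; only used for `x ∈ [0, L e]`
(other `x` are projected to that interval). -/
noncomputable def edgePoint (e : E) (x : ℝ) : Γ.Space :=
  Quot.mk _ (Sum.inr ⟨e, projIcc 0 (Γ.L e) (Γ.L_pos e).le x⟩)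

/-- Lebesgue measure on the edge `(0, L e)`. -/
noncomputable abbrev edgeMeasure (e : E) : Measure ℝ := volume.restrict (Ioo 0 (Γ.L e))

/-- The Hilbert space `L²(Γ) = ⨁ₑ L²(0, L e)` of complex-valued functions. -/
abbrev L2 : Type _ := PiLp 2 (fun e : E => Lp ℂ 2 (Γ.edgeMeasure e))

/-- The function `F` on `Γ` is a representative of `u ∈ L²(Γ)`. -/
def Represents (F : Γ.Space → ℂ) (u : Γ.L2) : Prop :=
  ∀ e, (u e : ℝ → ℂ) =ᵐ[Γ.edgeMeasure e] fun x => F (Γ.edgePoint e x)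

end CompactMetricGraph

/-! ### The Sobolev space `H²(0, ℓ)` -/

/-- `f` is the continuous representative of an element of the Sobolev space `H²(0, ℓ)`, `f'` is the
continuous representative of its (weak) first derivative, and `f''` is its weak second derivative:
`f` is the primitive of `f'` and `f'` is the primitive of `f'' ∈ L²(0, ℓ)`. -/
structure IsH2 (ℓ : ℝ) (f f' f'' : ℝ → ℂ) : Prop where
  memLp : MemLp f'' 2 (volume.restrict (Ioo 0 ℓ))
  deriv_eq : ∀ x ∈ Icc 0 ℓ, f' x = f' 0 + ∫ s in (0 : ℝ)..x, f'' s
  eq : ∀ x ∈ Icc 0 ℓ, f x = f 0 + ∫ s in (0 : ℝ)..x, f' s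

namespace IsH2

variable {ℓ : ℝ} {f f' f'' g g' g'' : ℝ → ℂ}

theorem intervalIntegrable_snd (h : IsH2 ℓ f f' f'') {x : ℝ} (hx : x ∈ Icc 0 ℓ) :
    IntervalIntegrable f'' volume 0 x := by
  rw [intervalIntegrable_iff_integrableOn_Ioo_of_le hx.1]
  exact IntegrableOn.mono_set (h.memLp.integrable one_le_two) (Ioo_subset_Ioo_right hx.2)

theorem continuousOn_primitive_of (h : ∀ x ∈ Icc 0 ℓ, f x = f 0 + ∫ s in (0 : ℝ)..x, g s)
    (hg : ∀ x ∈ Icc 0 ℓ, IntervalIntegrable g volume 0 x) : ContinuousOn f (Icc 0 ℓ) := by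
  rcases lt_or_ge ℓ 0 with hl | hl
  · simp [Icc_eq_empty (not_le.2 hl)]
  have h1 : IntegrableOn g (uIcc 0 ℓ) := by
    rw [uIcc_of_le hl, integrableOn_Icc_iff_integrableOn_Ioo]
    exact (intervalIntegrable_iff_integrableOn_Ioo_of_le hl).1 (hg ℓ (right_mem_Icc.2 hl))
  have h2 := intervalIntegral.continuousOn_primitive_interval h1
  rw [uIcc_of_le hl] at h2
  exact (continuousOn_const.add h2).congr h

theorem continuousOn_deriv (h : IsH2 ℓ f f' f'') : ContinuousOn f' (Icc 0 ℓ) :=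
  continuousOn_primitive_of h.deriv_eq fun _ hx => h.intervalIntegrable_snd hx

theorem intervalIntegrable_fst (h : IsH2 ℓ f f' f'') {x : ℝ} (hx : x ∈ Icc 0 ℓ) :
    IntervalIntegrable f' volume 0 x := by
  apply ContinuousOn.intervalIntegrable
  rw [uIcc_of_le hx.1]
  exact h.continuousOn_deriv.mono (Icc_subset_Icc_right hx.2)

theorem continuousOn (h : IsH2 ℓ f f' f'') : ContinuousOn f (Icc 0 ℓ) :=
  continuousOn_primitive_of h.eq fun _ hx => h.intervalIntegrable_fst hx

theorem add (hf : IsH2 ℓ f f' f'') (hg : IsH2 ℓ g g' g'') :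
    IsH2 ℓ (f + g) (f' + g') (f'' + g'') where
  memLp := hf.memLp.add hg.memLp
  deriv_eq x hx := by
    simp only [Pi.add_apply]
    rw [intervalIntegral.integral_add (hf.intervalIntegrable_snd hx) (hg.intervalIntegrable_snd hx),
      hf.deriv_eq x hx, hg.deriv_eq x hx]
    ring
  eq x hx := by
    simp only [Pi.add_apply]
    rw [intervalIntegral.integral_add (hf.intervalIntegrable_fst hx) (hg.intervalIntegrable_fst hx),
      hf.eq x hx, hg.eq x hx]
    ring

theorem smul (c : ℂ) (hf : IsH2 ℓ f f' f'') : IsH2 ℓ (c • f) (c • f') (c • f'') where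
  memLp := hf.memLp.const_smul c
  deriv_eq x hx := by
    simp only [Pi.smul_apply]
    rw [intervalIntegral.integral_smul, hf.deriv_eq x hx, smul_add]
  eq x hx := by
    simp only [Pi.smul_apply]
    rw [intervalIntegral.integral_smul, hf.eq x hx, smul_add]

theorem zero : IsH2 ℓ (0 : ℝ → ℂ) 0 0 where
  memLp := MemLp.zero
  deriv_eq x _ := by simp
  eq x _ := by simp

theorem ae_eq_zero_of_primitive {h : ℝ → ℂ} (hi : ∀ x ∈ Icc 0 ℓ, IntervalIntegrable h volume 0 x)
    (h0 : ∀ x ∈ Icc 0 ℓ, ∫ s in (0 : ℝ)..x, h s = 0) :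
    h =ᵐ[volume.restrict (Ioo 0 ℓ)] 0 := by
  rcases lt_or_ge ℓ 0 with hl | hl
  · simp [Ioo_eq_empty (not_lt.2 hl.le), Filter.EventuallyEq]
  have key := (hi ℓ (right_mem_Icc.2 hl)).ae_hasDerivAt_integral
  rw [Filter.EventuallyEq, ae_restrict_iff' measurableSet_Ioo]
  filter_upwards [key] with x hx hxI
  rw [uIcc_of_le hl] at hx
  have h1 := hx (Ioo_subset_Icc_self hxI) 0 (left_mem_Icc.2 hl)
  have h2 : (fun y => ∫ s in (0 : ℝ)..y, h s) =ᶠ[nhds x] fun _ => (0 : ℂ) := by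
    filter_upwards [isOpen_Ioo.mem_nhds hxI] with y hy using h0 y (Ioo_subset_Icc_self hy)
  exact h1.unique ((hasDerivAt_const x (0 : ℂ)).congr_of_eventuallyEq h2)

/-- The derivatives of an element of `H²(0, ℓ)` are determined by that element. -/
theorem of_ae_eq_zero (hl : 0 < ℓ) (hf : IsH2 ℓ f f' f'')
    (h0 : f =ᵐ[volume.restrict (Ioo 0 ℓ)] 0) :
    EqOn f 0 (Icc 0 ℓ) ∧ EqOn f' 0 (Icc 0 ℓ) ∧ f'' =ᵐ[volume.restrict (Ioo 0 ℓ)] 0 := by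
  have hz : (0 : ℝ) ∈ Icc 0 ℓ := left_mem_Icc.2 hl.le
  have e : volume.restrict (Ioo 0 ℓ) = volume.restrict (Icc 0 ℓ) :=
    Measure.restrict_congr_set Ioo_ae_eq_Icc
  have h1 : EqOn f 0 (Icc 0 ℓ) :=
    Measure.eqOn_Icc_of_ae_eq volume hl.ne (e ▸ h0) hf.continuousOn continuousOn_const
  have h2 : f' =ᵐ[volume.restrict (Ioo 0 ℓ)] 0 :=
    ae_eq_zero_of_primitive (fun x hx => hf.intervalIntegrable_fst hx) fun x hx => by
      have := hf.eq x hx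
      rw [h1 hx, h1 hz] at this
      simpa using this.symm
  have h3 : EqOn f' 0 (Icc 0 ℓ) :=
    Measure.eqOn_Icc_of_ae_eq volume hl.ne (e ▸ h2) hf.continuousOn_deriv continuousOn_const
  refine ⟨h1, h3, ae_eq_zero_of_primitive (fun x hx => hf.intervalIntegrable_snd hx) fun x hx => ?_⟩
  have := hf.deriv_eq x hx
  rw [h3 hx, h3 hz] at this
  simpa using this.symm

end IsH2

/-! ### The Schrödinger operator with `δ` coupling conditions -/

namespace CompactMetricGraph

variable {V E : Type*} [Fintype V] [Fintype E] (Γ : CompactMetricGraph V E)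

open Classical in
/-- The edge ends at the vertex `v`: `(e, false)` stands for the end `0` and `(e, true)` for the end
`L e` of the edge `e`. A loop contributes both of its ends; the cardinality is the degree of `v`. -/
noncomputable def ends (v : V) : Finset (E × Bool) :=
  Finset.univ.filter fun p => (if p.2 then Γ.t p.1 else Γ.o p.1) = v

/-- The entries of the vector `F(v)` of boundary values of `f`. -/
noncomputable def boundaryValue (f : E → ℝ → ℂ) (p : E × Bool) : ℂ :=
  if p.2 then f p.1 (Γ.L p.1) else f p.1 0

/-- The entries of the vector `F'(v)` of derivatives in the direction pointing out of the vertex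
into the edge, where `f'` is the family of derivatives along the edges. -/
noncomputable def outwardDerivative (f' : E → ℝ → ℂ) (p : E × Bool) : ℂ :=
  if p.2 then -f' p.1 (Γ.L p.1) else f' p.1 0

/-- The `δ` coupling condition of strength `a` at `v`: the vector `F(v)` is constant, and the
sum of the entries of `F'(v)` is `a` times its common entry. -/
def DeltaCondition (v : V) (a : ℝ) (f f' : E → ℝ → ℂ) : Prop :=
  (∀ p ∈ Γ.ends v, ∀ p' ∈ Γ.ends v, Γ.boundaryValue f p = Γ.boundaryValue f p') ∧
    ∀ p ∈ Γ.ends v, ∑ p' ∈ Γ.ends v, Γ.outwardDerivative f' p' = a * Γ.boundaryValue f p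

/-- The `δ` coupling condition in terms of the projection `𝒫` onto the constant vectors and its
complement `𝒬`: it says that `𝒬 F(v) = 0` and `𝒫 F'(v) = (a / deg v) 𝒫 F(v)`. -/
theorem deltaCondition_iff (v : V) (a : ℝ) (f f' : E → ℝ → ℂ) :
    Γ.DeltaCondition v a f f' ↔
      (∀ p ∈ Γ.ends v,
        Γ.boundaryValue f p - (∑ p' ∈ Γ.ends v, Γ.boundaryValue f p') / (Γ.ends v).card = 0) ∧
      (∑ p ∈ Γ.ends v, Γ.outwardDerivative f' p) / (Γ.ends v).card =
        a / (Γ.ends v).card * ((∑ p ∈ Γ.ends v, Γ.boundaryValue f p) / (Γ.ends v).card) := by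
  rcases (Γ.ends v).eq_empty_or_nonempty with h | ⟨p₀, h₀⟩
  · simp [DeltaCondition, h]
  have hd : ((Γ.ends v).card : ℂ) ≠ 0 := by
    exact_mod_cast (Finset.card_pos.2 ⟨p₀, h₀⟩).ne'
  constructor
  · rintro ⟨h1, h2⟩
    have hs : ∀ p ∈ Γ.ends v, (∑ p' ∈ Γ.ends v, Γ.boundaryValue f p') =
        (Γ.ends v).card * Γ.boundaryValue f p := fun p hp => by
      rw [Finset.sum_congr rfl fun p' hp' => h1 p' hp' p hp]
      simp
    refine ⟨fun p hp => ?_, ?_⟩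
    · rw [hs p hp]; field_simp; ring
    · rw [hs p₀ h₀, h2 p₀ h₀]; field_simp
  · rintro ⟨h1, h2⟩
    refine ⟨fun p hp p' hp' => by rw [sub_eq_zero.1 (h1 p hp), sub_eq_zero.1 (h1 p' hp')],
      fun p hp => ?_⟩
    rw [sub_eq_zero.1 (h1 p hp)]
    field_simp at h2 ⊢
    linear_combination h2

/-- `f` is a family of functions in `H²(0, L e)`, `e ∈ E`, with first and second derivatives `f'`
and `f''`, which satisfies at every vertex `v` the `δ` coupling condition of strength `α v`. -/
def InDomain (α : V → ℝ) (f f' f'' : E → ℝ → ℂ) : Prop :=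
  (∀ e, IsH2 (Γ.L e) (f e) (f' e) (f'' e)) ∧ ∀ v, Γ.DeltaCondition v (α v) f f'

theorem InDomain.add {α : V → ℝ} {f f' f'' g g' g'' : E → ℝ → ℂ}
    (hf : Γ.InDomain α f f' f'') (hg : Γ.InDomain α g g' g'') :
    Γ.InDomain α (f + g) (f' + g') (f'' + g'') := by
  have hb : ∀ p, Γ.boundaryValue (f + g) p = Γ.boundaryValue f p + Γ.boundaryValue g p := by
    intro p; simp only [boundaryValue, Pi.add_apply]; split_ifs <;> ring
  have hd : ∀ p, Γ.outwardDerivative (f' + g') p =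
      Γ.outwardDerivative f' p + Γ.outwardDerivative g' p := by
    intro p; simp only [outwardDerivative, Pi.add_apply]; split_ifs <;> ring
  refine ⟨fun e => (hf.1 e).add (hg.1 e), fun v => ⟨fun p hp p' hp' => ?_, fun p hp => ?_⟩⟩
  · rw [hb, hb, (hf.2 v).1 p hp p' hp', (hg.2 v).1 p hp p' hp']
  · rw [Finset.sum_congr rfl fun p' _ => hd p', Finset.sum_add_distrib, (hf.2 v).2 p hp,
      (hg.2 v).2 p hp, hb]
    ring

theorem InDomain.smul {α : V → ℝ} {f f' f'' : E → ℝ → ℂ} (c : ℂ) (hf : Γ.InDomain α f f' f'') :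
    Γ.InDomain α (c • f) (c • f') (c • f'') := by
  have hb : ∀ p, Γ.boundaryValue (c • f) p = c * Γ.boundaryValue f p := by
    intro p; simp only [boundaryValue, Pi.smul_apply, smul_eq_mul]; split_ifs <;> ring
  have hd : ∀ p, Γ.outwardDerivative (c • f') p = c * Γ.outwardDerivative f' p := by
    intro p; simp only [outwardDerivative, Pi.smul_apply, smul_eq_mul]; split_ifs <;> ring
  refine ⟨fun e => (hf.1 e).smul c, fun v => ⟨fun p hp p' hp' => ?_, fun p hp => ?_⟩⟩
  · rw [hb, hb, (hf.2 v).1 p hp p' hp']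
  · rw [Finset.sum_congr rfl fun p' _ => hd p', ← Finset.mul_sum, (hf.2 v).2 p hp, hb]
    ring

theorem InDomain.zero (α : V → ℝ) : Γ.InDomain α 0 0 0 :=
  ⟨fun _ => IsH2.zero, fun _ => by simp [DeltaCondition, boundaryValue, outwardDerivative]⟩

/-- The graph of the Schrödinger operator: all pairs `(u, w)` in `L²(Γ) × L²(Γ)` such that `u` is in
`⨁ₑ H²(0, L e)`, satisfies the `δ` coupling conditions, and `w = -u'' + q u` on every edge. -/
def schrodingerGraph (q : E → ℝ → ℝ) (α : V → ℝ) : Submodule ℂ (Γ.L2 × Γ.L2) where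
  carrier := {p | ∃ f f' f'' : E → ℝ → ℂ, Γ.InDomain α f f' f'' ∧
    (∀ e, (p.1 e : ℝ → ℂ) =ᵐ[Γ.edgeMeasure e] f e) ∧
    ∀ e, (p.2 e : ℝ → ℂ) =ᵐ[Γ.edgeMeasure e] fun x => -f'' e x + q e x * f e x}
  zero_mem' := by
    refine ⟨0, 0, 0, InDomain.zero Γ α, fun e => ?_, fun e => ?_⟩
    · exact Lp.coeFn_zero ℂ 2 (Γ.edgeMeasure e)
    · filter_upwards [Lp.coeFn_zero ℂ 2 (Γ.edgeMeasure e)] with x hx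
      simpa using hx
  add_mem' := by
    rintro ⟨u, w⟩ ⟨u₂, w₂⟩ ⟨f, f', f'', hf, hu, hw⟩ ⟨g, g', g'', hg, hu₂, hw₂⟩
    refine ⟨f + g, f' + g', f'' + g'', hf.add Γ hg, fun e => ?_, fun e => ?_⟩
    · filter_upwards [Lp.coeFn_add (u e) (u₂ e), hu e, hu₂ e] with x h1 h2 h3
      simpa [h2, h3] using h1
    · filter_upwards [Lp.coeFn_add (w e) (w₂ e), hw e, hw₂ e] with x h1 h2 h3
      refine h1.trans ?_
      simp only [Pi.add_apply] at h2 h3 ⊢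
      rw [h2, h3]
      ring
  smul_mem' := by
    rintro c ⟨u, w⟩ ⟨f, f', f'', hf, hu, hw⟩
    refine ⟨c • f, c • f', c • f'', hf.smul Γ c, fun e => ?_, fun e => ?_⟩
    · filter_upwards [Lp.coeFn_smul c (u e), hu e] with x h1 h2
      simpa [h2] using h1
    · filter_upwards [Lp.coeFn_smul c (w e), hw e] with x h1 h2
      refine h1.trans ?_
      simp only [Pi.smul_apply, smul_eq_mul] at h2 ⊢
      rw [h2]
      ring

theorem schrodingerGraph_functional (q : E → ℝ → ℝ) (α : V → ℝ) :
    ∀ p ∈ Γ.schrodingerGraph q α, p.1 = 0 → p.2 = 0 := by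
  rintro ⟨u, w⟩ ⟨f, f', f'', hf, hu, hw⟩ h0
  dsimp only at h0 hu hw ⊢
  subst h0
  ext1 e
  refine Lp.ext ?_
  have h1 : f e =ᵐ[Γ.edgeMeasure e] 0 :=
    (hu e).symm.trans (Lp.coeFn_zero ℂ 2 (Γ.edgeMeasure e))
  have h2 := ((hf.1 e).of_ae_eq_zero (Γ.L_pos e) h1).2.2
  filter_upwards [hw e, h1, h2, Lp.coeFn_zero ℂ 2 (Γ.edgeMeasure e)] with x a b c d
  rw [a, b, c]
  simpa using d.symm

/-- The Schrödinger operator `H` in `L²(Γ)` with potential `q` and with the `δ` coupling condition of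
strength `α v` at every vertex `v`, acting as `-u'' + q u` on every edge. -/
noncomputable def schrodinger (q : E → ℝ → ℝ) (α : V → ℝ) : Γ.L2 →ₗ.[ℂ] Γ.L2 :=
  (Γ.schrodingerGraph q α).toLinearPMap

theorem schrodinger_graph (q : E → ℝ → ℝ) (α : V → ℝ) :
    (Γ.schrodinger q α).graph = Γ.schrodingerGraph q α :=
  Submodule.toLinearPMap_graph_eq _ (Γ.schrodingerGraph_functional q α)

end CompactMetricGraph

/-- The space `ker (T - μ)` of a partially defined linear operator `T`: all `u` in the domain of `T`
such that `T u = μ u`. -/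
def eigenspace {X : Type*} [AddCommGroup X] [Module ℂ X] (T : X →ₗ.[ℂ] X) (μ : ℂ) :
    Submodule ℂ X :=
  T.graph.comap (LinearMap.id.prod (μ • LinearMap.id))

theorem mem_eigenspace {X : Type*} [AddCommGroup X] [Module ℂ X] (T : X →ₗ.[ℂ] X) (μ : ℂ) (u : X) :
    u ∈ eigenspace T μ ↔ ∃ h : u ∈ T.domain, T ⟨u, h⟩ = μ • u := by
  simp only [eigenspace, Submodule.mem_comap, LinearMap.prod_apply, Function.prod_apply,
    LinearMap.id_apply, LinearMap.smul_apply, LinearPMap.mem_graph_iff]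
  constructor
  · rintro ⟨y, rfl, h⟩
    exact ⟨y.2, h⟩
  · rintro ⟨h, h'⟩
    exact ⟨⟨u, h⟩, rfl, h'⟩

end QuantumGraph

namespace QuantumGraph

open Filter Topology

/-! ### Real functions in `H¹(0, ℓ)` -/

/-! The proof is variational and works with real functions. Let `A` be the energy form `∫ f'φ' + ∫ q
f φ + ∑ α f(v) φ(v)` on real `H¹(Γ)`, `N` the `L²` inner product, and `lam` the largest number with
`lam * N ≤ A` as quadratic forms. Put `s = A - lam • N`, which is nonnegative.

Existence (`exists_minimizer`): the trace estimate makes `A` coercive, and Arzelà–Ascoli makes a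
normalised minimising sequence subconverge in `L²`. Since `s` is nonnegative and tends to zero along
the sequence, `form_sub_le` makes differences of its terms small in `s` as well. By coercivity the
sequence is Cauchy in `H¹`, and its limit is a nonzero null vector of `s`.

Null vectors of `s` are the solutions of `f'' = (q - lam) f` with `δ` conditions. In one direction,
Cauchy–Schwarz for `s` (`form_eq_zero_of_self_eq_zero`) yields the Euler–Lagrange equations
(`exists_isSolution_of_minimizer`); in the other, integration by parts gives
`IsSolution.form_self_eq_zero`. The latter, applied at a level `μ < lam`, also excludes eigenvalues
below `lam`.

Positivity: passing from `f` to `|f|` does not increase `s`, so `|f|` is again a solution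
(`IsSolution.exists_abs`). If a nonnegative solution vanishes at a vertex, all outward derivatives
there are nonnegative with sum zero, hence all vanish. Uniqueness for the initial value problem
kills the function on the adjacent edges, and connectedness kills it everywhere
(`IsSolution.eq_zero_of_nonneg_of_vertex`). An interior zero reduces to this case. Thus a minimiser
has no zeros and its absolute value is strictly positive.

Simplicity: by the same argument for real and imaginary parts, an eigenfunction at `lam` vanishing
at one vertex is zero (`eq_zero_of_mem_eigenspace_of_vertex`). Subtracting from any eigenfunction
the multiple of the positive one with the same value at a chosen vertex leaves zero. Every
eigenfunction is therefore a multiple of the positive one, and a nonzero multiple has no zeros. -/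

theorem integral_Ioo_eq {ℓ : ℝ} (hl : 0 ≤ ℓ) (F : ℝ → ℝ) :
    ∫ x in Ioo 0 ℓ, F x = ∫ x in (0 : ℝ)..ℓ, F x := by
  rw [intervalIntegral.integral_of_le hl, integral_Ioc_eq_integral_Ioo]

/-- `f` is the continuous representative of a real element of `H¹(0, ℓ)`, and `g` is its weak
derivative. -/
structure IsH1 (ℓ : ℝ) (f g : ℝ → ℝ) : Prop where
  memLp : MemLp g 2 (volume.restrict (Ioo 0 ℓ))
  eq : ∀ x ∈ Icc 0 ℓ, f x = f 0 + ∫ s in (0 : ℝ)..x, g s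

theorem intervalIntegrable_of_integrableOn {ℓ a b : ℝ} {g : ℝ → ℝ} (hg : IntegrableOn g (Ioo 0 ℓ))
    (ha : a ∈ Icc 0 ℓ) (hb : b ∈ Icc 0 ℓ) : IntervalIntegrable g volume a b := by
  have h : IntervalIntegrable g volume 0 ℓ :=
    (intervalIntegrable_iff_integrableOn_Ioo_of_le (ha.1.trans ha.2)).2 hg
  refine h.mono_set ?_
  rw [uIcc_of_le (ha.1.trans ha.2)]
  exact (convex_Icc 0 ℓ).ordConnected.uIcc_subset ha hb

theorem continuousOn_of_primitive {ℓ : ℝ} {f g : ℝ → ℝ} (hg : IntegrableOn g (Ioo 0 ℓ))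
    (h : ∀ x ∈ Icc 0 ℓ, f x = f 0 + ∫ s in (0 : ℝ)..x, g s) : ContinuousOn f (Icc 0 ℓ) := by
  rcases lt_or_ge ℓ 0 with hl | hl
  · simp [Icc_eq_empty (not_le.2 hl)]
  have h1 : IntegrableOn g (uIcc 0 ℓ) := by
    rwa [uIcc_of_le hl, integrableOn_Icc_iff_integrableOn_Ioo]
  have h2 := intervalIntegral.continuousOn_primitive_interval h1
  rw [uIcc_of_le hl] at h2
  exact (continuousOn_const.add h2).congr h

theorem integrableOn_Ioo_of_continuousOn {ℓ : ℝ} {f : ℝ → ℝ} (hf : ContinuousOn f (Icc 0 ℓ)) :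
    IntegrableOn f (Ioo 0 ℓ) :=
  (hf.integrableOn_compact isCompact_Icc).mono_set Ioo_subset_Icc_self

/-- Integration by parts for two primitives of integrable functions. -/
theorem integral_mul_add_mul_of_primitive {ℓ : ℝ} (hl : 0 ≤ ℓ) {f g φ h : ℝ → ℝ}
    (hg : IntegrableOn g (Ioo 0 ℓ)) (hf : ∀ x ∈ Icc 0 ℓ, f x = f 0 + ∫ s in (0 : ℝ)..x, g s)
    (hh : IntegrableOn h (Ioo 0 ℓ)) (hφ : ∀ x ∈ Icc 0 ℓ, φ x = φ 0 + ∫ s in (0 : ℝ)..x, h s) :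
    ∫ x in Ioo 0 ℓ, (g x * φ x + f x * h x) = f ℓ * φ ℓ - f 0 * φ 0 := by
  have h0 : (0 : ℝ) ∈ Icc 0 ℓ := left_mem_Icc.2 hl
  have h1 : ℓ ∈ Icc 0 ℓ := right_mem_Icc.2 hl
  -- The given functions are controlled only on `[0, ℓ]`, so the product rule is applied to their
  -- primitives, which are absolutely continuous with the expected derivative almost everywhere.
  have key : ∀ {f g : ℝ → ℝ}, IntegrableOn g (Ioo 0 ℓ) →
      AbsolutelyContinuousOnInterval (fun x => f 0 + ∫ s in (0 : ℝ)..x, g s) 0 ℓ ∧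
      ∀ᵐ x, x ∈ uIcc 0 ℓ → deriv (fun x => f 0 + ∫ s in (0 : ℝ)..x, g s) x = g x := by
    intro f g hg
    have hi := intervalIntegrable_of_integrableOn hg h0 h1
    constructor
    · exact ((LipschitzWith.const (f 0)).lipschitzOnWith.absolutelyContinuousOnInterval).add
        (hi.absolutelyContinuousOnInterval_intervalIntegral (by simp))
    · filter_upwards [hi.ae_hasDerivAt_integral] with x hx hxI
      exact ((hx hxI 0 (by simp)).const_add _).deriv
  obtain ⟨a1, a2⟩ := key (f := f) hg
  obtain ⟨b1, b2⟩ := key (f := φ) hh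
  have := a1.integral_deriv_mul_eq_sub b1
  rw [← hf ℓ h1, ← hφ ℓ h1] at this
  simp only [intervalIntegral.integral_same, add_zero] at this
  rw [← this, integral_Ioo_eq hl]
  refine intervalIntegral.integral_congr_ae ?_
  filter_upwards [a2, b2] with x h2 h3 hx
  have hx' : x ∈ uIcc 0 ℓ := uIoc_subset_uIcc hx
  rw [h2 hx', h3 hx']
  rw [uIcc_of_le hl] at hx'
  rw [← hf x hx', ← hφ x hx']

namespace IsH1

variable {ℓ : ℝ} {f g : ℝ → ℝ}

theorem integrableOn (h : IsH1 ℓ f g) : IntegrableOn g (Ioo 0 ℓ) :=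
  h.memLp.integrable one_le_two

theorem continuousOn (h : IsH1 ℓ f g) : ContinuousOn f (Icc 0 ℓ) :=
  continuousOn_of_primitive h.integrableOn h.eq

theorem sub_eq (h : IsH1 ℓ f g) {a b : ℝ} (ha : a ∈ Icc 0 ℓ) (hb : b ∈ Icc 0 ℓ) :
    f b - f a = ∫ s in a..b, g s := by
  have h0 : (0 : ℝ) ∈ Icc 0 ℓ := left_mem_Icc.2 (ha.1.trans ha.2)
  rw [h.eq a ha, h.eq b hb, ← intervalIntegral.integral_interval_sub_left
    (intervalIntegrable_of_integrableOn h.integrableOn h0 hb)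
    (intervalIntegrable_of_integrableOn h.integrableOn h0 ha)]
  ring

theorem integrable_sq (h : IsH1 ℓ f g) : IntegrableOn (fun x => g x ^ 2) (Ioo 0 ℓ) :=
  h.memLp.integrable_sq

/-- Hölder continuity of the elements of `H¹(0, ℓ)`. -/
theorem sub_sq_le (h : IsH1 ℓ f g) {a b : ℝ} (ha : a ∈ Icc 0 ℓ) (hb : b ∈ Icc 0 ℓ) :
    (f b - f a) ^ 2 ≤ |b - a| * ∫ x in Ioo 0 ℓ, g x ^ 2 := by
  wlog hab : a ≤ b generalizing a b
  · have := this hb ha (not_le.1 hab).le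
    rwa [abs_sub_comm, ← neg_sub, neg_sq] at this
  rw [h.sub_eq ha hb, abs_of_nonneg (sub_nonneg.2 hab)]
  have hi := intervalIntegrable_of_integrableOn h.integrableOn ha hb
  have hi2 := intervalIntegrable_of_integrableOn h.integrable_sq ha hb
  set I := ∫ s in a..b, g s with hI
  have hJ : ∫ s in a..b, g s ^ 2 ≤ ∫ x in Ioo 0 ℓ, g x ^ 2 := by
    rw [integral_Ioo_eq (ha.1.trans ha.2)]
    refine intervalIntegral.integral_mono_interval ha.1 hab hb.2
      (Eventually.of_forall fun x => sq_nonneg _) ?_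
    exact intervalIntegrable_of_integrableOn h.integrable_sq
      (left_mem_Icc.2 (ha.1.trans ha.2)) (right_mem_Icc.2 (ha.1.trans ha.2))
  set J := ∫ s in a..b, g s ^ 2 with hJ'
  -- Cauchy–Schwarz by hand: the integrand is `((b - a) g - I)²`, and its integral is `(b - a) ((b -
  -- a) J - I²)`. Dividing by `b - a` requires `a < b`.
  have h1 : 0 ≤ ∫ s in a..b, ((b - a) ^ 2 * g s ^ 2 - 2 * (b - a) * I * g s + I ^ 2) := by
    refine intervalIntegral.integral_nonneg hab fun x _ => ?_
    nlinarith [sq_nonneg ((b - a) * g x - I)]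
  rw [intervalIntegral.integral_add ((hi2.const_mul _).sub (hi.const_mul _)) (by simp),
    intervalIntegral.integral_sub (hi2.const_mul _) (hi.const_mul _),
    intervalIntegral.integral_const_mul, intervalIntegral.integral_const_mul,
    intervalIntegral.integral_const, ← hI, ← hJ', smul_eq_mul] at h1
  have h2 : I ^ 2 ≤ (b - a) * J := by
    rcases hab.eq_or_lt with rfl | hlt
    · simp [hI]
    · have : 0 ≤ (b - a) * ((b - a) * J - I ^ 2) := by nlinarith
      have := nonneg_of_mul_nonneg_right this (sub_pos.2 hlt)
      linarith
  exact h2.trans (mul_le_mul_of_nonneg_left hJ (sub_nonneg.2 hab))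

theorem sq_integrableOn (h : IsH1 ℓ f g) : IntegrableOn (fun x => f x ^ 2) (Ioo 0 ℓ) :=
  integrableOn_Ioo_of_continuousOn (h.continuousOn.pow 2)

theorem add {f' g' : ℝ → ℝ} (h : IsH1 ℓ f g) (h' : IsH1 ℓ f' g') :
    IsH1 ℓ (f + f') (g + g') where
  memLp := h.memLp.add h'.memLp
  eq x hx := by
    have h0 : (0 : ℝ) ∈ Icc 0 ℓ := left_mem_Icc.2 (hx.1.trans hx.2)
    simp only [Pi.add_apply]
    rw [intervalIntegral.integral_add (intervalIntegrable_of_integrableOn h.integrableOn h0 hx)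
      (intervalIntegrable_of_integrableOn h'.integrableOn h0 hx), h.eq x hx, h'.eq x hx]
    ring

theorem smul (a : ℝ) (h : IsH1 ℓ f g) : IsH1 ℓ (a • f) (a • g) where
  memLp := h.memLp.const_smul a
  eq x hx := by
    simp only [Pi.smul_apply]
    rw [intervalIntegral.integral_smul, h.eq x hx, smul_add]

theorem const (ℓ a : ℝ) : IsH1 ℓ (fun _ => a) (fun _ => 0) where
  memLp := MemLp.zero
  eq x _ := by simp

/-- A trace estimate: the value at a point is controlled by the two `L²` norms. -/
theorem sq_le (h : IsH1 ℓ f g) {a b x : ℝ} (ha : 0 ≤ a) (hb : b ≤ ℓ) (hx : x ∈ Icc a b) :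
    (b - a) * f x ^ 2 ≤
      2 * (∫ y in Ioo 0 ℓ, f y ^ 2) + 2 * (b - a) ^ 2 * ∫ y in Ioo 0 ℓ, g y ^ 2 := by
  have hab : a ≤ b := hx.1.trans hx.2
  have hsub : Icc a b ⊆ Icc 0 ℓ := Icc_subset_Icc ha hb
  set G := ∫ y in Ioo 0 ℓ, g y ^ 2 with hG
  have hG0 : 0 ≤ G := integral_nonneg fun y => sq_nonneg _
  have hl : 0 ≤ ℓ := ha.trans (hab.trans hb)
  have hi : IntervalIntegrable (fun y => f y ^ 2) volume a b :=
    intervalIntegrable_of_integrableOn h.sq_integrableOn (hsub (left_mem_Icc.2 hab))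
      (hsub (right_mem_Icc.2 hab))
  -- Use `f(x)² ≤ 2 f(y)² + 2 (f(x) - f(y))²` with Hölder continuity, then average over `y ∈ [a,
  -- b]`. The interval is free, and a short one makes the coefficient of the gradient term small.
  have h1 : ∀ y ∈ Icc a b, f x ^ 2 ≤ 2 * f y ^ 2 + 2 * (b - a) * G := by
    intro y hy
    have h2 := h.sub_sq_le (hsub hy) (hsub hx)
    have h3 : |x - y| ≤ b - a := abs_le.2 ⟨by linarith [hx.1, hy.2], by linarith [hx.2, hy.1]⟩
    have h4 := mul_le_mul_of_nonneg_right h3 hG0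
    nlinarith [sq_nonneg (f x - 2 * f y)]
  have h2 : ∫ _ in a..b, f x ^ 2 ≤ ∫ y in a..b, (2 * f y ^ 2 + 2 * (b - a) * G) :=
    intervalIntegral.integral_mono_on hab (by simp) ((hi.const_mul _).add (by simp)) h1
  rw [intervalIntegral.integral_add (hi.const_mul _) (by simp),
    intervalIntegral.integral_const_mul, intervalIntegral.integral_const,
    intervalIntegral.integral_const, smul_eq_mul, smul_eq_mul] at h2
  have h3 : ∫ y in a..b, f y ^ 2 ≤ ∫ y in Ioo 0 ℓ, f y ^ 2 := by
    rw [integral_Ioo_eq hl]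
    refine intervalIntegral.integral_mono_interval ha hab hb
      (Eventually.of_forall fun x => sq_nonneg _) ?_
    exact intervalIntegrable_of_integrableOn h.sq_integrableOn (left_mem_Icc.2 hl)
      (right_mem_Icc.2 hl)
  nlinarith

end IsH1

/-- The absolute value of a `C¹` function is in `H¹`. -/
theorem isH1_abs {ℓ : ℝ} {f k : ℝ → ℝ} (hk : ContinuousOn k (Icc 0 ℓ))
    (hf : ∀ x ∈ Icc 0 ℓ, f x = f 0 + ∫ s in (0 : ℝ)..x, k s) :
    IsH1 ℓ (fun x => |f x|) (fun x => f x / |f x| * k x) := by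
  have hfc : ContinuousOn f (Icc 0 ℓ) :=
    continuousOn_of_primitive (integrableOn_Ioo_of_continuousOn hk) hf
  have hbd : ∀ x, ‖f x / |f x|‖ ≤ 1 := fun x => by
    rw [Real.norm_eq_abs, abs_div, abs_abs]; exact div_self_le_one _
  have hmeas : AEStronglyMeasurable (fun x => f x / |f x| * k x) (volume.restrict (Icc 0 ℓ)) := by
    have h1 := (hfc.aemeasurable measurableSet_Icc (μ := volume))
    have h2 := (hk.aemeasurable measurableSet_Icc (μ := volume))
    have h3 : AEMeasurable (fun x => |f x|) (volume.restrict (Icc 0 ℓ)) :=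
      continuous_abs.measurable.comp_aemeasurable h1
    exact ((h1.div h3).mul h2).aestronglyMeasurable
  constructor
  · have h1 : MemLp k 2 (volume.restrict (Icc 0 ℓ)) := by
      obtain ⟨C, hC⟩ := isCompact_Icc.exists_bound_of_continuousOn hk
      refine MemLp.of_bound (hk.aestronglyMeasurable measurableSet_Icc) C ?_
      rw [ae_restrict_iff' measurableSet_Icc]
      exact Eventually.of_forall hC
    have h2 : MemLp (fun x => f x / |f x| * k x) 2 (volume.restrict (Icc 0 ℓ)) := by
      refine h1.mono hmeas (Eventually.of_forall fun x => ?_)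
      rw [norm_mul]
      exact mul_le_of_le_one_left (norm_nonneg _) (hbd x)
    exact h2.mono_measure (Measure.restrict_mono_set _ Ioo_subset_Icc_self)
  · intro x hx
    have hsub : Icc 0 x ⊆ Icc 0 ℓ := Icc_subset_Icc_right hx.2
    -- Regularise `|f|` by `√(f² + ε n)`, which is differentiable also at zeros of `f`; apply the
    -- fundamental theorem of calculus and let `ε n → 0` by dominated convergence.
    let ε : ℕ → ℝ := fun n => 1 / ((n : ℝ) + 1)
    have hε : ∀ n, 0 < ε n := fun n => Nat.one_div_pos_of_nat
    have hεt : Tendsto ε atTop (𝓝 0) := tendsto_one_div_add_atTop_nhds_zero_nat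
    have hpos : ∀ n y, 0 < f y ^ 2 + ε n := fun n y => add_pos_of_nonneg_of_pos (sq_nonneg _) (hε n)
    have hcont : ∀ n, ContinuousOn (fun y => f y / √(f y ^ 2 + ε n) * k y) (Icc 0 x) := fun n =>
      (((hfc.mono hsub).div (((hfc.mono hsub).pow 2).add continuousOn_const).sqrt
        fun y _ => (Real.sqrt_pos.2 (hpos n y)).ne').mul (hk.mono hsub))
    have hFTC : ∀ n, ∫ y in (0 : ℝ)..x, f y / √(f y ^ 2 + ε n) * k y =
        √(f x ^ 2 + ε n) - √(f 0 ^ 2 + ε n) := by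
      intro n
      refine intervalIntegral.integral_eq_sub_of_hasDerivAt_of_le hx.1
        (((hfc.mono hsub).pow 2).add continuousOn_const).sqrt (fun y hy => ?_) ?_
      · have hyI : y ∈ Ioo 0 ℓ := ⟨hy.1, hy.2.trans_le hx.2⟩
        have hki : IntervalIntegrable k volume 0 y := by
          refine ContinuousOn.intervalIntegrable ?_
          rw [uIcc_of_le hy.1.le]
          exact hk.mono (Icc_subset_Icc_right hyI.2.le)
        have hnh : Icc 0 ℓ ∈ 𝓝 y := Icc_mem_nhds hyI.1 hyI.2
        have h1 : HasDerivAt f (k y) y := by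
          have h2 := intervalIntegral.integral_hasDerivAt_right hki
            ((hk.stronglyMeasurableAtFilter_nhdsWithin measurableSet_Icc y).filter_mono
              (le_inf le_rfl (le_principal_iff.2 hnh))) (hk.continuousAt hnh)
          refine (h2.const_add (f 0)).congr_of_eventuallyEq ?_
          filter_upwards [hnh] with z hz using hf z hz
        have h3 := ((h1.pow 2).add_const (ε n)).sqrt (hpos n y).ne'
        refine h3.congr_deriv ?_
        simp only [Nat.cast_ofNat, Nat.add_one_sub_one, pow_one, Pi.pow_apply]
        rw [mul_assoc, mul_div_mul_left _ _ two_ne_zero, mul_div_right_comm]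
      · refine ContinuousOn.intervalIntegrable ?_
        rw [uIcc_of_le hx.1]
        exact hcont n
    have hlim : Tendsto (fun n => ∫ y in (0 : ℝ)..x, f y / √(f y ^ 2 + ε n) * k y) atTop
        (𝓝 (∫ y in (0 : ℝ)..x, f y / |f y| * k y)) := by
      refine intervalIntegral.tendsto_integral_filter_of_dominated_convergence (fun y => |k y|)
        (Eventually.of_forall fun n => ?_) (Eventually.of_forall fun n => ?_) ?_ ?_
      · rw [uIoc_of_le hx.1]
        exact ((hcont n).mono Ioc_subset_Icc_self).aestronglyMeasurable measurableSet_Ioc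
      · refine Eventually.of_forall fun y _ => ?_
        rw [norm_mul]
        refine mul_le_of_le_one_left (norm_nonneg _) ?_
        rw [norm_div, Real.norm_eq_abs, Real.norm_of_nonneg (Real.sqrt_nonneg _),
          ← Real.sqrt_sq_eq_abs]
        exact div_le_one_of_le₀ (Real.sqrt_le_sqrt (by linarith [hε n])) (Real.sqrt_nonneg _)
      · refine (ContinuousOn.intervalIntegrable ?_).abs
        rw [uIcc_of_le hx.1]
        exact hk.mono hsub
      · refine Eventually.of_forall fun y _ => ?_
        refine Tendsto.mul_const _ ?_
        rcases eq_or_ne (f y) 0 with h0 | h0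
        -- At a zero of `f` the approximating quotients vanish, and so does `f / |f|` because `0 / 0
        -- = 0`.
        · simp [h0]
        · refine Tendsto.div tendsto_const_nhds ?_ (abs_ne_zero.2 h0)
          rw [← Real.sqrt_sq_eq_abs]
          have := (hεt.const_add (f y ^ 2)).sqrt
          simpa using this
    have hlim2 : Tendsto (fun n => √(f x ^ 2 + ε n) - √(f 0 ^ 2 + ε n)) atTop
        (𝓝 (|f x| - |f 0|)) := by
      rw [← Real.sqrt_sq_eq_abs, ← Real.sqrt_sq_eq_abs]
      have := ((hεt.const_add (f x ^ 2)).sqrt).sub ((hεt.const_add (f 0 ^ 2)).sqrt)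
      simpa using this
    simp only [hFTC] at hlim
    have := tendsto_nhds_unique hlim hlim2
    simp only [this]
    ring

/-! ### Uniqueness for the initial value problem -/

/-- Grönwall's lemma for an integral inequality without inhomogeneity. -/
theorem eq_zero_of_le_mul_integral {b K : ℝ} {m : ℝ → ℝ} (hm : ContinuousOn m (Icc 0 b))
    (h0 : ∀ t ∈ Icc 0 b, 0 ≤ m t) (h : ∀ t ∈ Icc 0 b, m t ≤ K * ∫ s in (0 : ℝ)..t, m s) :
    ∀ t ∈ Icc 0 b, m t = 0 := by
  intro t ht
  have hb : 0 ≤ b := ht.1.trans ht.2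
  have hint : IntegrableOn m (uIcc 0 b) := by
    rw [uIcc_of_le hb]; exact hm.integrableOn_compact isCompact_Icc
  -- The primitive `Φ` of `m` has right derivative `m ≤ K Φ` and `Φ 0 = 0`, so the differential form
  -- of Grönwall applies to it.
  have hΦ : ∀ x ∈ Icc 0 b, (∫ s in (0 : ℝ)..x, m s) = 0 := by
    refine eq_zero_of_abs_deriv_le_mul_abs_self_of_eq_zero_right (f' := m) (K := K) ?_ ?_ (by simp) ?_
    · have := intervalIntegral.continuousOn_primitive_interval hint
      rwa [uIcc_of_le hb] at this
    · intro x hx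
      have hxI : x ∈ Icc 0 b := Ico_subset_Icc_self hx
      have hnh : Icc 0 b ∈ 𝓝[>] x := by
        refine mem_of_superset (Ioo_mem_nhdsGT hx.2) fun y hy => ⟨hx.1.trans hy.1.le, hy.2.le⟩
      have hi : IntervalIntegrable m volume 0 x := by
        refine ContinuousOn.intervalIntegrable ?_
        rw [uIcc_of_le hx.1]
        exact hm.mono (Icc_subset_Icc_right hx.2.le)
      refine intervalIntegral.integral_hasDerivWithinAt_right hi (s := Ici x) (t := Ioi x) ?_ ?_
      · exact (hm.stronglyMeasurableAtFilter_nhdsWithin measurableSet_Icc x).filter_mono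
          (le_inf nhdsWithin_le_nhds (le_principal_iff.2 hnh))
      · exact (hm x hxI).mono_of_mem_nhdsWithin hnh
    · intro x hx
      have hxI : x ∈ Icc 0 b := Ico_subset_Icc_self hx
      rw [Real.norm_of_nonneg (h0 x hxI), Real.norm_of_nonneg]
      · exact h x hxI
      · exact intervalIntegral.integral_nonneg hx.1 fun y hy =>
          h0 y ⟨hy.1, hy.2.trans hx.2.le⟩
  have := h t ht
  rw [hΦ t ht, mul_zero] at this
  exact this.antisymm (h0 t ht)

theorem exists_ae_abs_le_of_memLp_top {X : Type*} [MeasurableSpace X] {μ : Measure X} {p : X → ℝ}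
    (hp : MemLp p ⊤ μ) : ∃ C : ℝ, 0 ≤ C ∧ ∀ᵐ x ∂μ, |p x| ≤ C := by
  refine ⟨(eLpNorm p ⊤ μ).toReal, ENNReal.toReal_nonneg, ?_⟩
  have := ae_le_eLpNormEssSup (f := p) (μ := μ)
  rw [← eLpNorm_exponent_top] at this
  filter_upwards [this] with x hx
  rw [← Real.norm_eq_abs, ← toReal_enorm]
  exact ENNReal.toReal_mono hp.2.ne hx

/-- Uniqueness for the initial value problem `f'' = p f`, `f(x₀) = f'(x₀) = 0`. -/
theorem eq_zero_of_initial_values {ℓ : ℝ} {p f k : ℝ → ℝ}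
    (hp : MemLp p ⊤ (volume.restrict (Ioo 0 ℓ)))
    (hfc : ContinuousOn f (Icc 0 ℓ)) (hkc : ContinuousOn k (Icc 0 ℓ))
    (hf : ∀ x ∈ Icc 0 ℓ, ∀ y ∈ Icc 0 ℓ, f y - f x = ∫ s in x..y, k s)
    (hk : ∀ x ∈ Icc 0 ℓ, ∀ y ∈ Icc 0 ℓ, k y - k x = ∫ s in x..y, p s * f s)
    {x₀ : ℝ} (hx₀ : x₀ ∈ Icc 0 ℓ) (hf0 : f x₀ = 0) (hk0 : k x₀ = 0) :
    ∀ x ∈ Icc 0 ℓ, f x = 0 := by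
  obtain ⟨C, hC0, hC⟩ := exists_ae_abs_le_of_memLp_top hp
  set m : ℝ → ℝ := fun x => |f x| + |k x| with hm
  have hmc : ContinuousOn m (Icc 0 ℓ) := hfc.abs.add hkc.abs
  have hII : ∀ {u : ℝ → ℝ} {x y : ℝ}, ContinuousOn u (Icc 0 ℓ) → x ∈ Icc 0 ℓ → y ∈ Icc 0 ℓ →
      IntervalIntegrable u volume x y := fun hu hx hy =>
    intervalIntegrable_of_integrableOn (integrableOn_Ioo_of_continuousOn hu) hx hy
  -- Treat `f' = k`, `k' = p f` as a first-order system: the first equation contributes `1` and the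
  -- second the essential bound `C` of `p`.
  have key : ∀ x ∈ Icc 0 ℓ, m x ≤ (1 + C) * |∫ s in x₀..x, m s| := by
    intro x hx
    have hle : ∀ {u : ℝ → ℝ}, (∀ s, 0 ≤ u s) → (∀ s, u s ≤ m s) → ContinuousOn u (Icc 0 ℓ) →
        |∫ s in x₀..x, u s| ≤ |∫ s in x₀..x, m s| := by
      intro u h0 h1 hu
      rw [intervalIntegral.abs_integral_eq_abs_integral_uIoc,
        intervalIntegral.abs_integral_eq_abs_integral_uIoc,
        abs_of_nonneg (integral_nonneg h0), abs_of_nonneg (integral_nonneg fun s =>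
          (h0 s).trans (h1 s))]
      exact integral_mono (intervalIntegrable_iff.1 (hII hu hx₀ hx))
        (intervalIntegrable_iff.1 (hII hmc hx₀ hx)) h1
    have h1 : |f x| ≤ |∫ s in x₀..x, m s| := by
      have := hf x₀ hx₀ x hx
      rw [hf0, sub_zero] at this
      rw [this]
      have h2 := intervalIntegral.norm_integral_le_abs_integral_norm (f := k) (a := x₀) (b := x)
        (μ := volume)
      exact h2.trans (hle (fun s => abs_nonneg _)
        (fun s => le_add_of_nonneg_left (abs_nonneg _)) hkc.abs)
    have h2 : |k x| ≤ C * |∫ s in x₀..x, m s| := by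
      have := hk x₀ hx₀ x hx
      rw [hk0, sub_zero] at this
      rw [this]
      have h3 : |∫ s in x₀..x, p s * f s| ≤ |∫ s in x₀..x, C * ‖f s‖| := by
        refine intervalIntegral.norm_integral_le_abs_of_norm_le (f := fun s => p s * f s)
          (g := fun s => C * ‖f s‖) ?_ ((hII hfc.abs hx₀ hx).const_mul C)
        rw [Measure.restrict_congr_set Ioo_ae_eq_Icc] at hC
        have hs : uIoc x₀ x ⊆ Icc 0 ℓ :=
          uIoc_subset_uIcc.trans ((convex_Icc 0 ℓ).ordConnected.uIcc_subset hx₀ hx)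
        filter_upwards [ae_mono (Measure.restrict_mono_set volume hs) hC] with s hs
        rw [norm_mul]
        exact mul_le_mul_of_nonneg_right hs (norm_nonneg _)
      rw [intervalIntegral.integral_const_mul, abs_mul, abs_of_nonneg hC0] at h3
      exact h3.trans (mul_le_mul_of_nonneg_left (hle (fun s => abs_nonneg _)
        (fun s => le_add_of_nonneg_right (abs_nonneg _)) hfc.abs) hC0)
    simp only [hm] at h1 h2 ⊢
    linarith
  have hm0 : ∀ x, 0 ≤ m x := fun x => add_nonneg (abs_nonneg _) (abs_nonneg _)
  have fin : ∀ x, m x = 0 → f x = 0 := fun x hx => by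
    have : |f x| ≤ m x := le_add_of_nonneg_right (abs_nonneg _)
    rw [hx] at this
    exact abs_eq_zero.1 (this.antisymm (abs_nonneg _))
  intro x hx
  refine fin x ?_
  -- Grönwall runs to the right of `x₀` directly, and to its left after the reflection `t ↦ x₀ - t`.
  rcases le_total x₀ x with h | h
  · have := eq_zero_of_le_mul_integral (b := ℓ - x₀) (K := 1 + C) (m := fun t => m (x₀ + t))
      (hmc.comp (by fun_prop) fun t ht => ⟨by linarith [ht.1, hx₀.1], by linarith [ht.2]⟩)
      (fun t _ => hm0 _) (fun t ht => ?_) (x - x₀) ⟨by linarith, by linarith [hx.2]⟩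
    · simpa using this
    · have h1 := key (x₀ + t) ⟨by linarith [ht.1, hx₀.1], by linarith [ht.2]⟩
      rw [intervalIntegral.integral_comp_add_left, add_zero]
      rwa [abs_of_nonneg (intervalIntegral.integral_nonneg (by linarith [ht.1]) fun s _ => hm0 s)]
        at h1
  · have := eq_zero_of_le_mul_integral (b := x₀) (K := 1 + C) (m := fun t => m (x₀ - t))
      (hmc.comp (by fun_prop) fun t ht => ⟨by linarith [ht.2], by linarith [ht.1, hx₀.2]⟩)
      (fun t _ => hm0 _) (fun t ht => ?_) (x₀ - x) ⟨by linarith, by linarith [hx.1]⟩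
    · simpa using this
    · have h1 := key (x₀ - t) ⟨by linarith [ht.2], by linarith [ht.1, hx₀.2]⟩
      rw [intervalIntegral.integral_comp_sub_left, sub_zero]
      rwa [intervalIntegral.integral_symm, abs_neg,
        abs_of_nonneg (intervalIntegral.integral_nonneg (by linarith [ht.1]) fun s _ => hm0 s)]
        at h1

/-! ### Tools for weak derivatives and for compactness -/

/-- A square integrable function which is orthogonal to all functions of mean zero is constant. -/
theorem exists_ae_eq_const_of_orthogonal {ℓ : ℝ} (hl : 0 < ℓ) {u : ℝ → ℝ}
    (hu : MemLp u 2 (volume.restrict (Ioo 0 ℓ)))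
    (h : ∀ v : ℝ → ℝ, MemLp v 2 (volume.restrict (Ioo 0 ℓ)) → ∫ x in Ioo 0 ℓ, v x = 0 →
      ∫ x in Ioo 0 ℓ, u x * v x = 0) :
    ∃ C : ℝ, u =ᵐ[volume.restrict (Ioo 0 ℓ)] fun _ => C := by
  -- The constant must be the mean of `u`; then `u - C` is itself an admissible test function, and
  -- testing with it gives `∫ (u - C)² = 0`.
  set C := (∫ x in Ioo 0 ℓ, u x) / ℓ with hC
  refine ⟨C, ?_⟩
  have hui : Integrable u (volume.restrict (Ioo 0 ℓ)) := hu.integrable one_le_two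
  have hv : MemLp (fun x => u x - C) 2 (volume.restrict (Ioo 0 ℓ)) := hu.sub (memLp_const C)
  have hv0 : ∫ x in Ioo 0 ℓ, (u x - C) = 0 := by
    rw [integral_sub hui (integrable_const C)]
    simp [hl.le, hC]
    field_simp
    ring
  have h1 := h _ hv hv0
  have h2 : ∫ x in Ioo 0 ℓ, (u x - C) ^ 2 = 0 := by
    have : ∀ x, (u x - C) ^ 2 = u x * (u x - C) - C * (u x - C) := fun x => by ring
    simp only [this]
    rw [integral_sub (f := fun x => u x * (u x - C)) (hu.integrable_mul hv) ((hv.integrable one_le_two).const_mul C), h1,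
      integral_const_mul, hv0]
    simp
  rw [integral_eq_zero_iff_of_nonneg (fun x => sq_nonneg _) hv.integrable_sq] at h2
  filter_upwards [h2] with x hx
  have : u x - C = 0 := by simpa using hx
  linarith

/-- A sequence of families of equi-Hölder and bounded functions on finitely many compact intervals
has a subsequence which converges uniformly. -/
theorem exists_subseq_tendstoUniformlyOn {ι : Type*} [Fintype ι] {ℓ : ι → ℝ} (hl : ∀ i, 0 < ℓ i)
    {f : ℕ → ι → ℝ → ℝ} {R : ℝ} (hb : ∀ n i, ∀ x ∈ Icc 0 (ℓ i), |f n i x| ≤ R)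
    (hh : ∀ n i, ∀ x ∈ Icc 0 (ℓ i), ∀ y ∈ Icc 0 (ℓ i), (f n i y - f n i x) ^ 2 ≤ |y - x| * R) :
    ∃ φ : ℕ → ℕ, StrictMono φ ∧ ∃ F : ι → ℝ → ℝ, ∀ i,
      TendstoUniformlyOn (fun n => f (φ n) i) (F i) atTop (Icc 0 (ℓ i)) := by
  set S := ∑ i, ℓ i with hS
  have hS0 : 0 ≤ S := Finset.sum_nonneg fun i _ => (hl i).le
  have hmem : ∀ (t : Icc (0 : ℝ) 1) i, (t : ℝ) * ℓ i ∈ Icc 0 (ℓ i) := fun t i =>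
    ⟨mul_nonneg t.2.1 (hl i).le, mul_le_of_le_one_left (hl i).le t.2.2⟩
  rcases isEmpty_or_nonempty ι with hι | ⟨⟨i₀⟩⟩
  · exact ⟨id, strictMono_id, fun i => isEmptyElim i, fun i => isEmptyElim i⟩
  have hR : 0 ≤ R := (abs_nonneg _).trans (hb 0 i₀ 0 (left_mem_Icc.2 (hl i₀).le))
  -- All intervals are rescaled to `[0, 1]`, so that one application of Arzelà–Ascoli to maps `[0,
  -- 1] → ι → ℝ` yields a subsequence common to all indices. The sum `S` dominates every `ℓ i` and
  -- gives one modulus of continuity.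
  have hmod : ∀ n (s t : Icc (0 : ℝ) 1), dist (fun i => f n i (s * ℓ i)) (fun i => f n i (t * ℓ i))
      ≤ √(|dist s t| * (S * R)) := by
    intro n s t
    refine (dist_pi_le_iff (Real.sqrt_nonneg _)).2 fun i => ?_
    rw [Real.dist_eq, ← Real.sqrt_sq_eq_abs]
    refine Real.sqrt_le_sqrt ((hh n i _ (hmem t i) _ (hmem s i)).trans ?_)
    rw [← sub_mul, abs_mul, abs_of_pos (hl i), abs_of_nonneg dist_nonneg, Subtype.dist_eq,
      Real.dist_eq, mul_assoc]
    refine mul_le_mul_of_nonneg_left (mul_le_mul_of_nonneg_right ?_ hR) (abs_nonneg _)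
    exact Finset.single_le_sum (f := ℓ) (fun j _ => (hl j).le) (Finset.mem_univ i)
  have hlim : Tendsto (fun r : ℝ => √(|r| * (S * R))) (𝓝 0) (𝓝 0) := by
    have : Continuous fun r : ℝ => √(|r| * (S * R)) := by fun_prop
    simpa using this.tendsto 0
  have hue : UniformEquicontinuous fun (n : ℕ) (t : Icc (0 : ℝ) 1) => fun i => f n i (t * ℓ i) :=
    Metric.uniformEquicontinuous_of_continuity_modulus _ hlim _ fun x y n => hmod n x y
  let G : ℕ → BoundedContinuousFunction (Icc (0 : ℝ) 1) (ι → ℝ) := fun n =>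
    BoundedContinuousFunction.mkOfCompact ⟨fun t i => f n i (t * ℓ i),
      (hue.uniformContinuous n).continuous⟩
  have hcomp : IsCompact (closure (range G)) := by
    refine BoundedContinuousFunction.arzela_ascoli (Metric.closedBall 0 R)
      (isCompact_closedBall _ _) _ ?_ ?_
    · rintro _ t ⟨n, rfl⟩
      rw [mem_closedBall_zero_iff]
      exact (pi_norm_le_iff_of_nonneg hR).2 fun i => hb n i _ (hmem t i)
    · intro t
      have h1 := hue.equicontinuous t
      intro U hU
      filter_upwards [h1 U hU] with s hs
      rintro ⟨_, n, rfl⟩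
      exact hs n
  obtain ⟨F, -, φ, hφ, hF⟩ := hcomp.tendsto_subseq fun n => subset_closure (mem_range_self n)
  refine ⟨φ, hφ, fun i x => F (projIcc 0 1 zero_le_one (x / ℓ i)) i, fun i => ?_⟩
  rw [BoundedContinuousFunction.tendsto_iff_tendstoUniformly] at hF
  rw [Metric.tendstoUniformlyOn_iff]
  rw [Metric.tendstoUniformly_iff] at hF
  intro ε hε
  filter_upwards [hF ε hε] with n hn x hx
  have h1 : x / ℓ i ∈ Icc (0 : ℝ) 1 := ⟨div_nonneg hx.1 (hl i).le, (div_le_one (hl i)).2 hx.2⟩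
  rw [projIcc_of_mem zero_le_one h1]
  have h2 := (dist_pi_lt_iff hε).1 (hn ⟨x / ℓ i, h1⟩) i
  simpa [G, div_mul_cancel₀ x (hl i).ne'] using h2

/-! ### The real Sobolev space `H¹(Γ)` -/

namespace CompactMetricGraph

variable {V E : Type*} [Fintype V] [Fintype E] (Γ : CompactMetricGraph V E)

/-- The real Sobolev space `H¹(Γ)`: triples consisting of the values at the vertices, the continuous
functions on the edges, and their weak derivatives. -/
def sobolev : Submodule ℝ ((V → ℝ) × (E → ℝ → ℝ) × (E → ℝ → ℝ)) where
  -- The derivative is stored as a function, not as a class, and values off `[0, L e]` are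
  -- arbitrary. The forms below are thus only semidefinite even where norms are meant, and the limit
  -- arguments use seminorms.
  carrier := {w | ∀ e, IsH1 (Γ.L e) (w.2.1 e) (w.2.2 e) ∧ w.2.1 e 0 = w.1 (Γ.o e) ∧
    w.2.1 e (Γ.L e) = w.1 (Γ.t e)}
  zero_mem' _ := ⟨IsH1.const _ 0, rfl, rfl⟩
  add_mem' hw hw' e := ⟨(hw e).1.add (hw' e).1, congrArg₂ (· + ·) (hw e).2.1 (hw' e).2.1,
    congrArg₂ (· + ·) (hw e).2.2 (hw' e).2.2⟩
  smul_mem' a _ hw e := ⟨(hw e).1.smul a, congrArg (a • ·) (hw e).2.1, congrArg (a • ·) (hw e).2.2⟩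

variable {Γ}

theorem sobolev_integrable_grad_mul (w w' : Γ.sobolev) (e : E) :
    Integrable (fun x => w.1.2.2 e x * w'.1.2.2 e x) (Γ.edgeMeasure e) :=
  (w.2 e).1.memLp.integrable_mul (w'.2 e).1.memLp

theorem integrable_bounded_mul {p : E → ℝ → ℝ} (hp : ∀ e, MemLp (p e) ⊤ (Γ.edgeMeasure e))
    {e : E} {u : ℝ → ℝ} (hu : Integrable u (Γ.edgeMeasure e)) :
    Integrable (fun x => p e x * u x) (Γ.edgeMeasure e) :=
  (hp e).integrable_mul (memLp_one_iff_integrable.2 hu)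

theorem sobolev_integrable_mul (w w' : Γ.sobolev) (e : E) :
    Integrable (fun x => w.1.2.1 e x * w'.1.2.1 e x) (Γ.edgeMeasure e) :=
  integrableOn_Ioo_of_continuousOn ((w.2 e).1.continuousOn.mul (w'.2 e).1.continuousOn)

variable (Γ)

/-! ### The bilinear forms -/

/-- The form `∫ f' φ'` on `H¹(Γ)`. -/
noncomputable def gradForm : LinearMap.BilinForm ℝ Γ.sobolev :=
  LinearMap.mk₂ ℝ (fun w w' => ∑ e, ∫ x, w.1.2.2 e x * w'.1.2.2 e x ∂Γ.edgeMeasure e)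
    (fun u v w => by
      rw [← Finset.sum_add_distrib]
      refine Finset.sum_congr rfl fun e _ => ?_
      rw [← integral_add (sobolev_integrable_grad_mul u w e) (sobolev_integrable_grad_mul v w e)]
      exact integral_congr_ae (Eventually.of_forall fun x => add_mul _ _ _))
    (fun a v w => by
      rw [smul_eq_mul, Finset.mul_sum]
      refine Finset.sum_congr rfl fun e _ => ?_
      rw [← integral_const_mul]
      exact integral_congr_ae (Eventually.of_forall fun x => mul_assoc _ _ _))
    (fun w u v => by
      rw [← Finset.sum_add_distrib]
      refine Finset.sum_congr rfl fun e _ => ?_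
      rw [← integral_add (sobolev_integrable_grad_mul w u e) (sobolev_integrable_grad_mul w v e)]
      exact integral_congr_ae (Eventually.of_forall fun x => mul_add _ _ _))
    (fun a w v => by
      rw [smul_eq_mul, Finset.mul_sum]
      refine Finset.sum_congr rfl fun e _ => ?_
      rw [← integral_const_mul]
      exact integral_congr_ae (Eventually.of_forall fun x => mul_left_comm _ _ _))

/-- The form `∫ p f φ` on `H¹(Γ)`, for a bounded potential `p`. -/
noncomputable def massForm (p : E → ℝ → ℝ) (hp : ∀ e, MemLp (p e) ⊤ (Γ.edgeMeasure e)) :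
    LinearMap.BilinForm ℝ Γ.sobolev :=
  LinearMap.mk₂ ℝ (fun w w' => ∑ e, ∫ x, p e x * (w.1.2.1 e x * w'.1.2.1 e x) ∂Γ.edgeMeasure e)
    (fun u v w => by
      rw [← Finset.sum_add_distrib]
      refine Finset.sum_congr rfl fun e _ => ?_
      rw [← integral_add (integrable_bounded_mul hp (sobolev_integrable_mul u w e))
        (integrable_bounded_mul hp (sobolev_integrable_mul v w e))]
      refine integral_congr_ae (Eventually.of_forall fun x => ?_)
      simp only [Submodule.coe_add, Prod.fst_add, Prod.snd_add, Pi.add_apply]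
      ring)
    (fun a v w => by
      rw [smul_eq_mul, Finset.mul_sum]
      refine Finset.sum_congr rfl fun e _ => ?_
      rw [← integral_const_mul]
      refine integral_congr_ae (Eventually.of_forall fun x => ?_)
      simp only [Submodule.coe_smul, Prod.smul_fst, Prod.smul_snd, Pi.smul_apply, smul_eq_mul]
      ring)
    (fun w u v => by
      rw [← Finset.sum_add_distrib]
      refine Finset.sum_congr rfl fun e _ => ?_
      rw [← integral_add (integrable_bounded_mul hp (sobolev_integrable_mul w u e))
        (integrable_bounded_mul hp (sobolev_integrable_mul w v e))]
      refine integral_congr_ae (Eventually.of_forall fun x => ?_)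
      simp only [Submodule.coe_add, Prod.fst_add, Prod.snd_add, Pi.add_apply]
      ring)
    (fun a w v => by
      rw [smul_eq_mul, Finset.mul_sum]
      refine Finset.sum_congr rfl fun e _ => ?_
      rw [← integral_const_mul]
      refine integral_congr_ae (Eventually.of_forall fun x => ?_)
      simp only [Submodule.coe_smul, Prod.smul_fst, Prod.smul_snd, Pi.smul_apply, smul_eq_mul]
      ring)

/-- The form `∑ α f(v) φ(v)` on `H¹(Γ)`. -/
noncomputable def vertexForm (α : V → ℝ) : LinearMap.BilinForm ℝ Γ.sobolev :=
  LinearMap.mk₂ ℝ (fun w w' => ∑ v, α v * (w.1.1 v * w'.1.1 v))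
    (fun u v w => by
      rw [← Finset.sum_add_distrib]
      refine Finset.sum_congr rfl fun e _ => ?_
      simp only [Submodule.coe_add, Prod.fst_add, Pi.add_apply]
      ring)
    (fun a v w => by
      rw [smul_eq_mul, Finset.mul_sum]
      refine Finset.sum_congr rfl fun e _ => ?_
      simp only [Submodule.coe_smul, Prod.smul_fst, Pi.smul_apply, smul_eq_mul]
      ring)
    (fun w u v => by
      rw [← Finset.sum_add_distrib]
      refine Finset.sum_congr rfl fun e _ => ?_
      simp only [Submodule.coe_add, Prod.fst_add, Pi.add_apply]
      ring)
    (fun a w v => by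
      rw [smul_eq_mul, Finset.mul_sum]
      refine Finset.sum_congr rfl fun e _ => ?_
      simp only [Submodule.coe_smul, Prod.smul_fst, Pi.smul_apply, smul_eq_mul]
      ring)

theorem memLp_one_top (e : E) : MemLp ((fun _ _ => 1 : E → ℝ → ℝ) e) ⊤ (Γ.edgeMeasure e) :=
  memLp_const 1

/-- The inner product of `L²(Γ)` on `H¹(Γ)`. -/
noncomputable def normForm : LinearMap.BilinForm ℝ Γ.sobolev :=
  Γ.massForm (fun _ _ => 1) Γ.memLp_one_top

/-- The quadratic form of the Schrödinger operator. -/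
noncomputable def energyForm (q : E → ℝ → ℝ) (hq : ∀ e, MemLp (q e) ⊤ (Γ.edgeMeasure e))
    (α : V → ℝ) : LinearMap.BilinForm ℝ Γ.sobolev :=
  Γ.gradForm + Γ.massForm q hq + Γ.vertexForm α

variable {Γ}

theorem gradForm_apply (w w' : Γ.sobolev) :
    Γ.gradForm w w' = ∑ e, ∫ x in Ioo 0 (Γ.L e), w.1.2.2 e x * w'.1.2.2 e x := rfl

theorem massForm_apply {p : E → ℝ → ℝ} (hp : ∀ e, MemLp (p e) ⊤ (Γ.edgeMeasure e))
    (w w' : Γ.sobolev) : Γ.massForm p hp w w' =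
      ∑ e, ∫ x in Ioo 0 (Γ.L e), p e x * (w.1.2.1 e x * w'.1.2.1 e x) := rfl

theorem vertexForm_apply (α : V → ℝ) (w w' : Γ.sobolev) :
    Γ.vertexForm α w w' = ∑ v, α v * (w.1.1 v * w'.1.1 v) := rfl

theorem gradForm_self (w : Γ.sobolev) :
    Γ.gradForm w w = ∑ e, ∫ x in Ioo 0 (Γ.L e), w.1.2.2 e x ^ 2 := by
  simp only [gradForm_apply, sq]

theorem normForm_self (w : Γ.sobolev) :
    Γ.normForm w w = ∑ e, ∫ x in Ioo 0 (Γ.L e), w.1.2.1 e x ^ 2 := by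
  simp only [normForm, massForm_apply, one_mul, sq]

theorem normForm_nonneg (w : Γ.sobolev) : 0 ≤ Γ.normForm w w := by
  rw [normForm_self]
  exact Finset.sum_nonneg fun e _ => integral_nonneg fun x => sq_nonneg _

theorem gradForm_nonneg (w : Γ.sobolev) : 0 ≤ Γ.gradForm w w := by
  rw [gradForm_self]
  exact Finset.sum_nonneg fun e _ => integral_nonneg fun x => sq_nonneg _

theorem integral_sq_le_normForm (w : Γ.sobolev) (e : E) :
    ∫ x in Ioo 0 (Γ.L e), w.1.2.1 e x ^ 2 ≤ Γ.normForm w w := by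
  rw [normForm_self]
  exact Finset.single_le_sum (f := fun e => ∫ x in Ioo 0 (Γ.L e), w.1.2.1 e x ^ 2)
    (fun e _ => integral_nonneg fun x => sq_nonneg _) (Finset.mem_univ e)

theorem integral_grad_sq_le_gradForm (w : Γ.sobolev) (e : E) :
    ∫ x in Ioo 0 (Γ.L e), w.1.2.2 e x ^ 2 ≤ Γ.gradForm w w := by
  rw [gradForm_self]
  exact Finset.single_le_sum (f := fun e => ∫ x in Ioo 0 (Γ.L e), w.1.2.2 e x ^ 2)
    (fun e _ => integral_nonneg fun x => sq_nonneg _) (Finset.mem_univ e)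

theorem energyForm_isSymm (q : E → ℝ → ℝ) (hq : ∀ e, MemLp (q e) ⊤ (Γ.edgeMeasure e))
    (α : V → ℝ) (w w' : Γ.sobolev) : Γ.energyForm q hq α w w' = Γ.energyForm q hq α w' w := by
  simp only [energyForm, LinearMap.add_apply, gradForm_apply, massForm_apply, vertexForm_apply,
    mul_comm (w.1.1 _), mul_comm (w.1.2.1 _ _), mul_comm (w.1.2.2 _ _)]

theorem normForm_isSymm (w w' : Γ.sobolev) : Γ.normForm w w' = Γ.normForm w' w := by
  simp only [normForm, massForm_apply, mul_comm (w.1.2.1 _ _)]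

/-- Add `B (u + v) (u + v) ≥ 0` to the left-hand side and expand; no symmetry is needed. This
replaces the triangle inequality for semidefinite forms. -/
theorem form_sub_le (B : LinearMap.BilinForm ℝ Γ.sobolev) (hB : ∀ w, 0 ≤ B w w)
    (u v : Γ.sobolev) : B (u - v) (u - v) ≤ 2 * B u u + 2 * B v v := by
  have := hB (u + v)
  simp only [map_add, map_sub, LinearMap.add_apply, LinearMap.sub_apply] at this ⊢
  linarith

/-! ### Bounds for the forms and coercivity -/

theorem exists_abs_massForm_le (p : E → ℝ → ℝ) (hp : ∀ e, MemLp (p e) ⊤ (Γ.edgeMeasure e)) :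
    ∃ C, 0 ≤ C ∧ ∀ w : Γ.sobolev, |Γ.massForm p hp w w| ≤ C * Γ.normForm w w := by
  choose C hC0 hC using fun e => exists_ae_abs_le_of_memLp_top (hp e)
  refine ⟨∑ e, C e, Finset.sum_nonneg fun e _ => hC0 e, fun w => ?_⟩
  rw [massForm_apply, normForm_self, Finset.mul_sum]
  refine (Finset.abs_sum_le_sum_abs _ _).trans (Finset.sum_le_sum fun e _ => ?_)
  rw [← integral_const_mul]
  rw [← Real.norm_eq_abs]
  refine norm_integral_le_of_norm_le (((w.2 e).1.sq_integrableOn).const_mul _) ?_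
  filter_upwards [hC e] with x hx
  rw [norm_mul, Real.norm_eq_abs, Real.norm_eq_abs, ← sq, abs_of_nonneg (sq_nonneg (w.1.2.1 e x))]
  exact mul_le_mul_of_nonneg_right (hx.trans
    (Finset.single_le_sum (fun e _ => hC0 e) (Finset.mem_univ e))) (sq_nonneg _)

theorem exists_pos_le_length (Γ : CompactMetricGraph V E) : ∃ δ, 0 < δ ∧ ∀ e, δ ≤ Γ.L e := by
  rcases isEmpty_or_nonempty E with h | h
  · exact ⟨1, one_pos, fun e => isEmptyElim e⟩
  · obtain ⟨e, he⟩ := Finite.exists_min Γ.L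
    exact ⟨Γ.L e, Γ.L_pos e, he⟩

/-- The value at a non-isolated vertex is controlled by the two `L²` norms. -/
theorem vertex_sq_le (w : Γ.sobolev) {v : V} (hv : ∃ e, Γ.o e = v ∨ Γ.t e = v) {δ : ℝ}
    (hδ0 : 0 < δ) (hδ : ∀ e, δ ≤ Γ.L e) :
    w.1.1 v ^ 2 ≤ 2 / δ * Γ.normForm w w + 2 * δ * Γ.gradForm w w := by
  obtain ⟨e, he⟩ := hv
  -- The trace estimate is used on the piece of length `δ` of an incident edge next to `v`.
  have key : δ * w.1.1 v ^ 2 ≤ 2 * (∫ y in Ioo 0 (Γ.L e), w.1.2.1 e y ^ 2) +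
      2 * δ ^ 2 * ∫ y in Ioo 0 (Γ.L e), w.1.2.2 e y ^ 2 := by
    rcases he with rfl | rfl
    · have := (w.2 e).1.sq_le le_rfl (hδ e) (left_mem_Icc.2 hδ0.le)
      rwa [(w.2 e).2.1, sub_zero] at this
    · have := (w.2 e).1.sq_le (a := Γ.L e - δ) (by linarith [hδ e]) le_rfl
        (right_mem_Icc.2 (by linarith))
      rwa [(w.2 e).2.2, sub_sub_cancel] at this
  have h1 := integral_sq_le_normForm w e
  have h2 := mul_le_mul_of_nonneg_left (integral_grad_sq_le_gradForm w e)
    (show 0 ≤ 2 * δ ^ 2 by positivity)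
  rw [← mul_le_mul_iff_right₀ hδ0]
  have h3 : δ * (2 / δ * Γ.normForm w w + 2 * δ * Γ.gradForm w w) =
      2 * Γ.normForm w w + 2 * δ ^ 2 * Γ.gradForm w w := by field_simp
  rw [h3]
  linarith

/-- Coercivity of the quadratic form. -/
theorem exists_gradForm_le (hΓ : ∀ v, ∃ e, Γ.o e = v ∨ Γ.t e = v) (q : E → ℝ → ℝ)
    (hq : ∀ e, MemLp (q e) ⊤ (Γ.edgeMeasure e)) (α : V → ℝ) :
    ∃ C, 0 ≤ C ∧ ∀ w, Γ.gradForm w w ≤ 2 * Γ.energyForm q hq α w w + C * Γ.normForm w w := by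
  obtain ⟨C, hC0, hC⟩ := exists_abs_massForm_le q hq
  obtain ⟨δ₀, hδ₀, hδ₀'⟩ := Γ.exists_pos_le_length
  set A := ∑ v, |α v| with hA
  have hA0 : 0 ≤ A := Finset.sum_nonneg fun v _ => abs_nonneg _
  -- The gradient part of the vertex terms is at most `2 * A * δ` times `gradForm`. With `4 * A * δ
  -- ≤ 1` this is half of it, which can be absorbed.
  set δ := min δ₀ (1 / (4 * A + 1)) with hδ
  have hδ0 : 0 < δ := lt_min hδ₀ (by positivity)
  have hδA : 4 * A * δ ≤ 1 := by
    have h1 : δ * (4 * A + 1) ≤ 1 := by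
      rw [← le_div_iff₀ (by positivity)]
      exact min_le_right _ _
    nlinarith
  refine ⟨2 * C + 2 * A * (2 / δ), by positivity, fun w => ?_⟩
  have hN := normForm_nonneg w
  have hG := gradForm_nonneg w
  have h1 := (abs_le.1 (hC w)).1
  have h2 : -(A * (2 / δ * Γ.normForm w w + 2 * δ * Γ.gradForm w w)) ≤ Γ.vertexForm α w w := by
    rw [vertexForm_apply, hA, Finset.sum_mul, ← Finset.sum_neg_distrib]
    refine Finset.sum_le_sum fun v _ => ?_
    have h3 := mul_le_mul_of_nonneg_left
      (vertex_sq_le w (hΓ v) hδ0 fun e => (min_le_left _ _).trans (hδ₀' e)) (abs_nonneg (α v))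
    have h4 := mul_le_mul_of_nonneg_right (neg_abs_le (α v)) (sq_nonneg (w.1.1 v))
    nlinarith
  simp only [energyForm, LinearMap.add_apply]
  nlinarith [mul_le_mul_of_nonneg_right hδA hG]

/-- Pointwise bound by the vertex values and the derivative. -/
theorem apply_sq_le (w : Γ.sobolev) (e : E) {x : ℝ} (hx : x ∈ Icc 0 (Γ.L e)) :
    w.1.2.1 e x ^ 2 ≤ 2 * w.1.1 (Γ.o e) ^ 2 + 2 * Γ.L e * Γ.gradForm w w := by
  have h1 := (w.2 e).1.sub_sq_le (left_mem_Icc.2 (Γ.L_pos e).le) hx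
  rw [(w.2 e).2.1, sub_zero, abs_of_nonneg hx.1] at h1
  have h2 := mul_le_mul hx.2 (integral_grad_sq_le_gradForm w e)
    (integral_nonneg fun x => sq_nonneg _) (Γ.L_pos e).le
  nlinarith [sq_nonneg (w.1.2.1 e x - 2 * w.1.1 (Γ.o e))]

theorem normForm_le_of_bound (w : Γ.sobolev) {M : ℝ}
    (h : ∀ e, ∀ x ∈ Icc 0 (Γ.L e), w.1.2.1 e x ^ 2 ≤ M) :
    Γ.normForm w w ≤ (∑ e, Γ.L e) * M := by
  rw [normForm_self, Finset.sum_mul]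
  refine Finset.sum_le_sum fun e _ => ?_
  have h1 : ∫ x in Ioo 0 (Γ.L e), w.1.2.1 e x ^ 2 ≤ ∫ _ in Ioo 0 (Γ.L e), M :=
    setIntegral_mono_on (w.2 e).1.sq_integrableOn (integrable_const M) measurableSet_Ioo
      fun x hx => h e x (Ioo_subset_Icc_self hx)
  simpa [(Γ.L_pos e).le] using h1

end CompactMetricGraph

/-! ### Existence of a minimizer -/

theorem norm_toLp_sq {X : Type*} [MeasurableSpace X] {μ : Measure X} {h : X → ℝ}
    (hh : MemLp h 2 μ) : ‖hh.toLp h‖ ^ 2 = ∫ x, h x ^ 2 ∂μ := by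
  rw [← real_inner_self_eq_norm_sq, L2.inner_def]
  refine integral_congr_ae ?_
  filter_upwards [hh.coeFn_toLp] with x hx
  rw [hx, real_inner_self_eq_norm_sq, Real.norm_eq_abs, sq_abs]

/-- A Cauchy sequence of square integrable functions has a limit. -/
theorem exists_tendsto_integral_sub_sq {X : Type*} [MeasurableSpace X] {μ : Measure X}
    {g : ℕ → X → ℝ} (hg : ∀ n, MemLp (g n) 2 μ)
    (hc : ∀ ε > 0, ∃ N, ∀ m ≥ N, ∀ n ≥ N, ∫ x, (g m x - g n x) ^ 2 ∂μ ≤ ε) :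
    ∃ h, MemLp h 2 μ ∧ Tendsto (fun n => ∫ x, (g n x - h x) ^ 2 ∂μ) atTop (𝓝 0) := by
  let G : ℕ → Lp ℝ 2 μ := fun n => (hg n).toLp (g n)
  have hG : CauchySeq G := by
    rw [Metric.cauchySeq_iff]
    intro ε hε
    obtain ⟨N, hN⟩ := hc ((ε / 2) ^ 2) (by positivity)
    refine ⟨N, fun m hm n hn => ?_⟩
    have h1 := hN m hm n hn
    have h2 := norm_toLp_sq ((hg m).sub (hg n))
    rw [MemLp.toLp_sub (hg m) (hg n)] at h2
    simp only [Pi.sub_apply] at h2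
    rw [← h2] at h1
    have h3 := abs_le_of_sq_le_sq h1 (by positivity)
    rw [dist_eq_norm]
    exact (le_abs_self _).trans_lt (h3.trans_lt (half_lt_self hε))
  obtain ⟨h, hh⟩ := cauchySeq_tendsto_of_complete hG
  refine ⟨h, Lp.memLp h, ?_⟩
  have h1 := (tendsto_iff_norm_sub_tendsto_zero.1 hh).pow 2
  rw [zero_pow two_ne_zero] at h1
  refine h1.congr fun n => ?_
  have h2 := norm_toLp_sq ((hg n).sub (Lp.memLp h))
  rw [MemLp.toLp_sub (hg n) (Lp.memLp h), Lp.toLp_coeFn] at h2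
  exact h2

namespace CompactMetricGraph

variable {V E : Type*} [Fintype V] [Fintype E] {Γ : CompactMetricGraph V E}

/-! ### Completeness and compactness -/

/-- Completeness of `H¹(Γ)`. -/
theorem exists_tendsto_gradForm {w : ℕ → Γ.sobolev}
    (hc : ∀ v, ∃ c, Tendsto (fun n => (w n).1.1 v) atTop (𝓝 c))
    (hg : ∀ ε > 0, ∃ N, ∀ m ≥ N, ∀ n ≥ N, Γ.gradForm (w m - w n) (w m - w n) ≤ ε) :
    ∃ u : Γ.sobolev, (∀ v, Tendsto (fun n => (w n - u).1.1 v) atTop (𝓝 0)) ∧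
      Tendsto (fun n => Γ.gradForm (w n - u) (w n - u)) atTop (𝓝 0) := by
  choose c hc using hc
  have hge : ∀ e, ∃ h, MemLp h 2 (Γ.edgeMeasure e) ∧
      Tendsto (fun n => ∫ x in Ioo 0 (Γ.L e), ((w n).1.2.2 e x - h x) ^ 2) atTop (𝓝 0) := by
    refine fun e => exists_tendsto_integral_sub_sq (fun n => ((w n).2 e).1.memLp) fun ε hε => ?_
    obtain ⟨N, hN⟩ := hg ε hε
    exact ⟨N, fun m hm n hn =>
      (integral_grad_sq_le_gradForm (w m - w n) e).trans (hN m hm n hn)⟩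
  choose g hgm hgt using hge
  -- The limit is rebuilt from the limits of the vertex values and of the derivatives, integrating
  -- from the origin of each edge. What remains is the value at the terminus.
  let u : (V → ℝ) × (E → ℝ → ℝ) × (E → ℝ → ℝ) :=
    (c, fun e x => c (Γ.o e) + ∫ s in (0 : ℝ)..x, g e s, g)
  have hH1 : ∀ e, IsH1 (Γ.L e) (u.2.1 e) (u.2.2 e) := fun e => ⟨hgm e, fun x _ => by simp [u]⟩
  have hu : u ∈ Γ.sobolev := by
    refine fun e => ⟨hH1 e, by simp [u], ?_⟩
    have hd : ∀ n, IsH1 (Γ.L e) ((w n).1.2.1 e - u.2.1 e) ((w n).1.2.2 e - u.2.2 e) := fun n => by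
      rw [sub_eq_add_neg, sub_eq_add_neg, ← neg_one_smul ℝ (u.2.1 e), ← neg_one_smul ℝ (u.2.2 e)]
      exact ((w n).2 e).1.add ((hH1 e).smul (-1))
    -- Hölder continuity of `w n - u` compares its two end values; the right-hand side tends to
    -- zero, so `u` takes the value `c (Γ.t e)` at the terminus.
    have h1 : ∀ n, (((w n).1.1 (Γ.t e) - u.2.1 e (Γ.L e)) - ((w n).1.1 (Γ.o e) - c (Γ.o e))) ^ 2 ≤
        |Γ.L e - 0| * ∫ x in Ioo 0 (Γ.L e), ((w n).1.2.2 e x - g e x) ^ 2 := fun n => by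
      have := (hd n).sub_sq_le (left_mem_Icc.2 (Γ.L_pos e).le) (right_mem_Icc.2 (Γ.L_pos e).le)
      simp only [Pi.sub_apply] at this
      rw [((w n).2 e).2.1, ((w n).2 e).2.2] at this
      simpa [u] using this
    have h2 : Tendsto (fun n => (((w n).1.1 (Γ.t e) - u.2.1 e (Γ.L e)) -
        ((w n).1.1 (Γ.o e) - c (Γ.o e))) ^ 2) atTop
        (𝓝 (((c (Γ.t e) - u.2.1 e (Γ.L e)) - (c (Γ.o e) - c (Γ.o e))) ^ 2)) :=
      (((hc _).sub_const _).sub ((hc _).sub_const _)).pow 2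
    have h3 := le_of_tendsto_of_tendsto' h2 ((hgt e).const_mul _) h1
    rw [mul_zero, sub_self, sub_zero] at h3
    have h4 := pow_eq_zero_iff (two_ne_zero) |>.1 (h3.antisymm (sq_nonneg _))
    exact (sub_eq_zero.1 h4).symm
  refine ⟨⟨u, hu⟩, fun v => ?_, ?_⟩
  · have := (hc v).sub_const (c v)
    rwa [sub_self] at this
  · have : Tendsto (fun n => ∑ e, ∫ x in Ioo 0 (Γ.L e), ((w n).1.2.2 e x - g e x) ^ 2) atTop
        (𝓝 (∑ _e : E, 0)) := tendsto_finsetSum _ fun e _ => hgt e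
    rw [Finset.sum_const_zero] at this
    refine this.congr fun n => ?_
    rw [gradForm_self]
    rfl

/-- Compactness of the embedding of `H¹(Γ)` into the continuous functions. -/
theorem exists_subseq_normForm_cauchy (hΓ : ∀ v, ∃ e, Γ.o e = v ∨ Γ.t e = v) {w : ℕ → Γ.sobolev}
    {R : ℝ} (hG : ∀ n, Γ.gradForm (w n) (w n) ≤ R) (hN : ∀ n, Γ.normForm (w n) (w n) ≤ R) :
    ∃ φ : ℕ → ℕ, StrictMono φ ∧
      (∀ v, ∃ c, Tendsto (fun n => (w (φ n)).1.1 v) atTop (𝓝 c)) ∧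
      ∀ ε > 0, ∃ N, ∀ m ≥ N, ∀ n ≥ N,
        Γ.normForm (w (φ m) - w (φ n)) (w (φ m) - w (φ n)) ≤ ε := by
  have hR : 0 ≤ R := (normForm_nonneg _).trans (hN 0)
  -- A single constant must bound both the functions and their squared Hölder constants. The summand
  -- `1` comes from `|t| ≤ t² + 1`, and `R` covers the Hölder part.
  set M := (∑ e, (2 * R / Γ.L e + 2 * Γ.L e * R)) + 1 + R with hM
  have hterm : ∀ e, 0 ≤ 2 * R / Γ.L e + 2 * Γ.L e * R := fun e => by
    have := Γ.L_pos e
    positivity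
  have hMR : R ≤ M := by
    have := Finset.sum_nonneg fun e (_ : e ∈ Finset.univ) => hterm e
    linarith
  have hb : ∀ n e, ∀ x ∈ Icc 0 (Γ.L e), |(w n).1.2.1 e x| ≤ M := by
    intro n e x hx
    have h1 := ((w n).2 e).1.sq_le le_rfl le_rfl hx
    have hL := Γ.L_pos e
    have h2 := (integral_sq_le_normForm (w n) e).trans (hN n)
    have h3 := mul_le_mul_of_nonneg_left ((integral_grad_sq_le_gradForm (w n) e).trans (hG n))
      (show 0 ≤ 2 * (Γ.L e) ^ 2 by positivity)
    have h4 : (w n).1.2.1 e x ^ 2 ≤ 2 * R / Γ.L e + 2 * Γ.L e * R := by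
      rw [← mul_le_mul_iff_right₀ hL]
      have : Γ.L e * (2 * R / Γ.L e + 2 * Γ.L e * R) = 2 * R + 2 * Γ.L e ^ 2 * R := by
        field_simp
      rw [this]
      rw [sub_zero] at h1
      linarith
    have h5 := Finset.single_le_sum (f := fun e => 2 * R / Γ.L e + 2 * Γ.L e * R)
      (fun e _ => hterm e) (Finset.mem_univ e)
    have h6 : |(w n).1.2.1 e x| ≤ (w n).1.2.1 e x ^ 2 + 1 := by
      rw [← sq_abs]
      nlinarith [sq_nonneg (|(w n).1.2.1 e x| - 1)]
    linarith
  obtain ⟨φ, hφ, F, hF⟩ := exists_subseq_tendstoUniformlyOn Γ.L_pos hb fun n e x hx y hy =>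
    (((w n).2 e).1.sub_sq_le hx hy).trans (mul_le_mul_of_nonneg_left
      (((integral_grad_sq_le_gradForm (w n) e).trans (hG n)).trans hMR) (abs_nonneg _))
  refine ⟨φ, hφ, fun v => ?_, fun ε hε => ?_⟩
  · obtain ⟨e, rfl | rfl⟩ := hΓ v
    · refine ⟨F e 0, ((hF e).tendsto_at (left_mem_Icc.2 (Γ.L_pos e).le)).congr fun n => ?_⟩
      exact ((w (φ n)).2 e).2.1
    · refine ⟨F e (Γ.L e), ((hF e).tendsto_at (right_mem_Icc.2 (Γ.L_pos e).le)).congr fun n => ?_⟩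
      exact ((w (φ n)).2 e).2.2
  · set S := ∑ e, Γ.L e with hS
    have hS0 : 0 ≤ S := Finset.sum_nonneg fun e _ => (Γ.L_pos e).le
    set η := √(ε / (S + 1)) with hη
    have hη0 : 0 < η := Real.sqrt_pos.2 (by positivity)
    have hη2 : η ^ 2 = ε / (S + 1) := Real.sq_sqrt (by positivity)
    have h1 : ∀ᶠ n in atTop, ∀ e, ∀ x ∈ Icc 0 (Γ.L e),
        dist (F e x) ((w (φ n)).1.2.1 e x) < η / 2 := by
      rw [eventually_all]
      exact fun e => Metric.tendstoUniformlyOn_iff.1 (hF e) _ (half_pos hη0)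
    obtain ⟨N, hN⟩ := eventually_atTop.1 h1
    refine ⟨N, fun m hm n hn => ?_⟩
    refine (normForm_le_of_bound (M := η ^ 2) _ fun e x hx => ?_).trans ?_
    · have h2 := hN m hm e x hx
      have h3 := hN n hn e x hx
      have h4 : |(w (φ m)).1.2.1 e x - (w (φ n)).1.2.1 e x| ≤ η := by
        rw [← Real.dist_eq]
        refine (dist_triangle_left _ _ (F e x)).trans ?_
        linarith
      exact sq_le_sq' (abs_le.1 h4).1 (abs_le.1 h4).2
    · rw [hη2, mul_div_assoc', div_le_iff₀ (by positivity)]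
      nlinarith

/-- The constant function `1`. -/
def sobolevOne (Γ : CompactMetricGraph V E) : Γ.sobolev :=
  ⟨(fun _ => 1, fun _ _ => 1, fun _ _ => 0), fun _ => ⟨IsH1.const _ 1, rfl, rfl⟩⟩

theorem normForm_sobolevOne : Γ.normForm Γ.sobolevOne Γ.sobolevOne = ∑ e, Γ.L e := by
  rw [normForm_self]
  refine Finset.sum_congr rfl fun e _ => ?_
  simp [sobolevOne, (Γ.L_pos e).le]

/-- The infimum of the Rayleigh quotient is attained. -/
theorem exists_minimizer [Nonempty E] (hΓ : ∀ v, ∃ e, Γ.o e = v ∨ Γ.t e = v) (q : E → ℝ → ℝ)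
    (hq : ∀ e, MemLp (q e) ⊤ (Γ.edgeMeasure e)) (α : V → ℝ) :
    ∃ lam : ℝ, (∀ w, 0 ≤ (Γ.energyForm q hq α - lam • Γ.normForm) w w) ∧
      ∃ w, (Γ.energyForm q hq α - lam • Γ.normForm) w w = 0 ∧ 0 < Γ.normForm w w := by
  set A := Γ.energyForm q hq α with hA
  set N := Γ.normForm with hN
  obtain ⟨C, hC0, hC⟩ := exists_gradForm_le hΓ q hq α
  -- The lower bounds of the Rayleigh quotient, written without division. Coercivity shows that some
  -- exist, and the constant function `1` bounds them above.
  set S := {μ : ℝ | ∀ w, μ * N w w ≤ A w w} with hS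
  have hSne : S.Nonempty := ⟨-(C / 2), fun w => by
    have := hC w
    have := gradForm_nonneg w
    linarith⟩
  have hN1 : 0 < N Γ.sobolevOne Γ.sobolevOne := by
    rw [hN, normForm_sobolevOne]
    exact Finset.sum_pos (fun e _ => Γ.L_pos e) Finset.univ_nonempty
  have hSbdd : BddAbove S := ⟨A Γ.sobolevOne Γ.sobolevOne / N Γ.sobolevOne Γ.sobolevOne,
    fun μ hμ => (le_div_iff₀ hN1).2 (hμ _)⟩
  set lam := sSup S with hlam
  have hlamS : ∀ w, lam * N w w ≤ A w w := by
    intro w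
    rcases (normForm_nonneg w).eq_or_lt with h0 | h0
    · obtain ⟨μ, hμ⟩ := hSne
      have := hμ w
      rw [hN, ← h0, mul_zero] at this ⊢
      exact this
    · rw [← le_div_iff₀ h0]
      exact csSup_le hSne fun μ hμ => (le_div_iff₀ h0).2 (hμ w)
  set s := A - lam • N with hs
  have hsapp : ∀ w, s w w = A w w - lam * N w w := fun w => rfl
  have hs0 : ∀ w, 0 ≤ s w w := fun w => sub_nonneg.2 (hlamS w)
  refine ⟨lam, hs0, ?_⟩
  -- A normalised minimising sequence: `lam + 1 / (n + 1)` is no longer a lower bound, and a `w`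
  -- witnessing this has `N w w > 0` because `lam` is one.
  have hseq : ∀ n : ℕ, ∃ w, N w w = 1 ∧ s w w ≤ 1 / ((n : ℝ) + 1) := by
    intro n
    have hpos : (0 : ℝ) < 1 / ((n : ℝ) + 1) := Nat.one_div_pos_of_nat
    have hnot : lam + 1 / ((n : ℝ) + 1) ∉ S := fun h => by
      have := le_csSup hSbdd h
      linarith
    simp only [hS, mem_ofPred_eq, not_forall, not_le] at hnot
    obtain ⟨w, hw⟩ := hnot
    have hNw : 0 < N w w := by
      refine (normForm_nonneg w).lt_of_ne fun h0 => ?_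
      have := hlamS w
      rw [hN, ← h0] at this hw
      linarith
    refine ⟨(√(N w w))⁻¹ • w, ?_, ?_⟩
    · simp only [map_smul, LinearMap.smul_apply, smul_eq_mul]
      rw [← mul_assoc, ← mul_inv, Real.mul_self_sqrt hNw.le, inv_mul_cancel₀ hNw.ne']
    · simp only [map_smul, LinearMap.smul_apply, smul_eq_mul]
      rw [← mul_assoc, ← mul_inv, Real.mul_self_sqrt hNw.le, hsapp, inv_mul_le_iff₀ hNw]
      linarith
  choose w hwN hws using hseq
  have hws1 : ∀ n, s (w n) (w n) ≤ 1 := fun n => (hws n).trans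
    (by rw [div_le_one (by positivity)]; linarith [n.cast_nonneg (α := ℝ)])
  have hcoer : ∀ u, Γ.gradForm u u ≤ 2 * s u u + (C + 2 * |lam|) * N u u := fun u => by
    have h1 := hC u
    have h2 := mul_le_mul_of_nonneg_right (le_abs_self lam) (normForm_nonneg u)
    rw [hsapp]
    linarith
  have hwG : ∀ n, Γ.gradForm (w n) (w n) ≤ 3 + C + 2 * |lam| := fun n => by
    have := hcoer (w n)
    rw [hwN] at this
    linarith [hws1 n]
  obtain ⟨φ, hφ, hc, hcauchy⟩ := exists_subseq_normForm_cauchy hΓ hwG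
    (fun n => (hwN n).le.trans (by linarith [abs_nonneg lam]))
  have hst : Tendsto (fun n => s (w (φ n)) (w (φ n))) atTop (𝓝 0) :=
    squeeze_zero (fun n => hs0 _) (fun n => hws (φ n))
      (tendsto_one_div_add_atTop_nhds_zero_nat.comp hφ.tendsto_atTop)
  set K := C + 2 * |lam| + 1 with hK
  have hK0 : 0 < K := by positivity
  -- For the differences, `2 * s` is below `ε / 2` by `form_sub_le` (this fixes `ε / 16`), and `K *
  -- N` is at most `ε / 2` by compactness. Coercivity then makes the sequence Cauchy for `gradForm`,
  -- so it converges strongly and no weak lower semicontinuity is needed.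
  obtain ⟨u, huc, huG⟩ := exists_tendsto_gradForm (w := fun n => w (φ n)) hc fun ε hε => by
    obtain ⟨N₁, hN₁⟩ := hcauchy (ε / (2 * K)) (by positivity)
    obtain ⟨N₂, hN₂⟩ := eventually_atTop.1 (hst.eventually (gt_mem_nhds (show 0 < ε / 16 by positivity)))
    refine ⟨max N₁ N₂, fun m hm n hn => ?_⟩
    have h1 := hN₁ m (le_of_max_le_left hm) n (le_of_max_le_left hn)
    have h2 := hN₂ m (le_of_max_le_right hm)
    have h3 := hN₂ n (le_of_max_le_right hn)
    have h4 := hcoer (w (φ m) - w (φ n))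
    have h5 := form_sub_le s hs0 (w (φ m)) (w (φ n))
    have h6 : K * N (w (φ m) - w (φ n)) (w (φ m) - w (φ n)) ≤ ε / 2 := by
      rw [le_div_iff₀ (by positivity)] at h1
      linarith
    have h7 := normForm_nonneg (w (φ m) - w (φ n))
    nlinarith
  have hNt : Tendsto (fun n => N (w (φ n) - u) (w (φ n) - u)) atTop (𝓝 0) := by
    refine squeeze_zero (fun n => normForm_nonneg _)
      (fun n => (normForm_self _).trans_le (Finset.sum_le_sum fun e _ => ?_))
      (g := fun n => ∑ e, Γ.L e * (2 * (w (φ n) - u).1.1 (Γ.o e) ^ 2 +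
        2 * Γ.L e * Γ.gradForm (w (φ n) - u) (w (φ n) - u))) ?_
    · have h1 : ∫ x in Ioo 0 (Γ.L e), (w (φ n) - u).1.2.1 e x ^ 2 ≤
          ∫ _ in Ioo 0 (Γ.L e), (2 * (w (φ n) - u).1.1 (Γ.o e) ^ 2 +
            2 * Γ.L e * Γ.gradForm (w (φ n) - u) (w (φ n) - u)) :=
        setIntegral_mono_on ((w (φ n) - u).2 e).1.sq_integrableOn (integrable_const _)
          measurableSet_Ioo fun x hx => apply_sq_le _ e (Ioo_subset_Icc_self hx)
      rw [setIntegral_const] at h1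
      simpa only [Real.volume_real_Ioo_of_le (Γ.L_pos e).le, sub_zero, smul_eq_mul] using h1
    · have : Tendsto (fun n => ∑ e, Γ.L e * (2 * (w (φ n) - u).1.1 (Γ.o e) ^ 2 +
        2 * Γ.L e * Γ.gradForm (w (φ n) - u) (w (φ n) - u))) atTop
          (𝓝 (∑ e, Γ.L e * (2 * 0 ^ 2 + 2 * Γ.L e * 0))) :=
        tendsto_finsetSum _ fun e _ => ((((huc _).pow 2).const_mul 2).add
          (huG.const_mul _)).const_mul _
      simpa using this
  have hVt : Tendsto (fun n => Γ.vertexForm α (w (φ n) - u) (w (φ n) - u)) atTop (𝓝 0) := by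
    have : Tendsto (fun n => Γ.vertexForm α (w (φ n) - u) (w (φ n) - u)) atTop
        (𝓝 (∑ v, α v * (0 * 0))) :=
      tendsto_finsetSum _ fun v _ => ((huc v).mul (huc v)).const_mul _
    simpa using this
  have hMt : Tendsto (fun n => Γ.massForm q hq (w (φ n) - u) (w (φ n) - u)) atTop (𝓝 0) := by
    obtain ⟨C', -, hC'⟩ := exists_abs_massForm_le q hq
    refine squeeze_zero_norm (fun n => hC' _) ?_
    simpa using hNt.const_mul C'
  have hsu : Tendsto (fun n => s (w (φ n) - u) (w (φ n) - u)) atTop (𝓝 0) := by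
    have := ((huG.add hMt).add hVt).sub (hNt.const_mul lam)
    rw [mul_zero, add_zero, add_zero, sub_zero] at this
    exact this
  refine ⟨u, le_antisymm ?_ (hs0 u), ?_⟩
  · have h1 : ∀ n, s u u ≤ 2 * s (w (φ n)) (w (φ n)) + 2 * s (w (φ n) - u) (w (φ n) - u) := by
      intro n
      have := form_sub_le s hs0 (w (φ n)) (w (φ n) - u)
      rwa [sub_sub_cancel] at this
    have h2 := (hst.const_mul 2).add (hsu.const_mul 2)
    rw [mul_zero, add_zero] at h2
    exact ge_of_tendsto' h2 h1
  -- Normalisation survives up to a factor: in the limit `1 ≤ 2 * N u u`.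
  · have h1 : ∀ n, 1 ≤ 2 * N (w (φ n) - u) (w (φ n) - u) + 2 * N u u := by
      intro n
      have := form_sub_le N normForm_nonneg (w (φ n) - u) (-u)
      rw [sub_neg_eq_add, sub_add_cancel, hwN] at this
      simpa using this
    have h2 := (hNt.const_mul 2).add_const (2 * N u u)
    have h3 := ge_of_tendsto' h2 h1
    linarith

end CompactMetricGraph

/-! ### Eigenfunctions as critical points -/

/-- The derivative of a nonnegative function at a zero points into the interval. -/
theorem mul_deriv_nonneg_of_zero {ℓ : ℝ} {f k : ℝ → ℝ} (hk : ContinuousOn k (Icc 0 ℓ))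
    (hf : ∀ x ∈ Icc 0 ℓ, f x = f 0 + ∫ s in (0 : ℝ)..x, k s) (h0 : ∀ x ∈ Icc 0 ℓ, 0 ≤ f x)
    {x y : ℝ} (hx : x ∈ Icc 0 ℓ) (hy : y ∈ Icc 0 ℓ) (hfx : f x = 0) : 0 ≤ (y - x) * k x := by
  -- Provides the `FTCFilter` instance for derivatives within `Icc 0 ℓ`, one-sided at the end
  -- points.
  have : Fact (x ∈ Icc 0 ℓ) := ⟨hx⟩
  have h1 : HasDerivWithinAt (fun z => ∫ s in (0 : ℝ)..z, k s) (k x) (Icc 0 ℓ) x :=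
    intervalIntegral.integral_hasDerivWithinAt_right
      (intervalIntegrable_of_integrableOn (integrableOn_Ioo_of_continuousOn hk)
        (left_mem_Icc.2 (hx.1.trans hx.2)) hx)
      (hk.stronglyMeasurableAtFilter_nhdsWithin measurableSet_Icc x) (hk x hx)
  have h2 : HasDerivWithinAt f (k x) (Icc 0 ℓ) x :=
    (h1.const_add (f 0)).congr hf (hf x hx)
  have h3 : IsLocalMinOn f (Icc 0 ℓ) x := by
    filter_upwards [self_mem_nhdsWithin] with z hz
    rw [hfx]
    exact h0 z hz
  have h4 := h3.hasFDerivWithinAt_nonneg h2.hasFDerivWithinAt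
    (sub_mem_posTangentConeAt_of_segment_subset ((convex_Icc 0 ℓ).segment_subset hx hy))
  simpa using h4

namespace CompactMetricGraph

variable {V E : Type*} [Fintype V] [Fintype E] (Γ : CompactMetricGraph V E)

/-- `f` is a continuous real function on `Γ` with vertex values `c` and derivatives `k` which solves
`f'' = p f` on every edge. -/
structure IsSolution (p : E → ℝ → ℝ) (c : V → ℝ) (f k : E → ℝ → ℝ) : Prop where
  continuousOn : ∀ e, ContinuousOn (f e) (Icc 0 (Γ.L e))
  continuousOn_deriv : ∀ e, ContinuousOn (k e) (Icc 0 (Γ.L e))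
  eq : ∀ e, ∀ x ∈ Icc 0 (Γ.L e), f e x = f e 0 + ∫ s in (0 : ℝ)..x, k e s
  deriv_eq : ∀ e, ∀ x ∈ Icc 0 (Γ.L e), k e x = k e 0 + ∫ s in (0 : ℝ)..x, p e s * f e s
  origin : ∀ e, f e 0 = c (Γ.o e)
  terminus : ∀ e, f e (Γ.L e) = c (Γ.t e)

/-- The derivative of a real function in the direction pointing out of the vertex. -/
noncomputable def outward (k : E → ℝ → ℝ) (p : E × Bool) : ℝ :=
  if p.2 then -k p.1 (Γ.L p.1) else k p.1 0

/-- The `δ` condition for the outward derivatives. -/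
def Kirchhoff (α c : V → ℝ) (k : E → ℝ → ℝ) : Prop :=
  ∀ v, ∑ p ∈ Γ.ends v, Γ.outward k p = α v * c v

theorem mem_ends {v : V} {p : E × Bool} :
    p ∈ Γ.ends v ↔ (if p.2 then Γ.t p.1 else Γ.o p.1) = v := by
  simp [ends]

/-- The two boundary terms of an edge are minus its outward derivatives weighted by `d`; regrouping
the edge ends by vertex gives the right-hand side. Indexing by `E × Bool` counts both ends of a
loop. -/
theorem sum_edges_eq_sum_vertices (k : E → ℝ → ℝ) (d : V → ℝ) :
    ∑ e, (k e (Γ.L e) * d (Γ.t e) - k e 0 * d (Γ.o e)) =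
      -∑ v, d v * ∑ p ∈ Γ.ends v, Γ.outward k p := by
  classical
  have h1 : ∑ v, d v * ∑ p ∈ Γ.ends v, Γ.outward k p =
      ∑ p : E × Bool, d (if p.2 then Γ.t p.1 else Γ.o p.1) * Γ.outward k p := by
    rw [← Finset.sum_fiberwise_of_maps_to (s := Finset.univ) (t := Finset.univ)
      (g := fun p : E × Bool => if p.2 then Γ.t p.1 else Γ.o p.1) fun _ _ => Finset.mem_univ _]
    refine Finset.sum_congr rfl fun v _ => ?_
    rw [Finset.mul_sum]
    refine Finset.sum_congr (by ext p; simp [mem_ends]) fun p hp => ?_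
    rw [(Γ.mem_ends).1 hp]
  rw [h1, Fintype.sum_prod_type, ← Finset.sum_neg_distrib]
  refine Finset.sum_congr rfl fun e _ => ?_
  simp [outward]
  ring

variable {Γ}

theorem memLp_sub_const {q : E → ℝ → ℝ} (hq : ∀ e, MemLp (q e) ⊤ (Γ.edgeMeasure e)) (lam : ℝ)
    (e : E) : MemLp (fun x => q e x - lam) ⊤ (Γ.edgeMeasure e) :=
  (hq e).sub (memLp_const lam)

/-- Collecting each edge contribution under one integral prepares both integration by parts and the
pointwise comparison of `f` with `|f|`. -/
theorem energyForm_sub_apply (q : E → ℝ → ℝ) (hq : ∀ e, MemLp (q e) ⊤ (Γ.edgeMeasure e))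
    (α : V → ℝ) (lam : ℝ) (w w' : Γ.sobolev) :
    (Γ.energyForm q hq α - lam • Γ.normForm) w w' =
      (∑ e, ∫ x in Ioo 0 (Γ.L e), (w.1.2.2 e x * w'.1.2.2 e x +
        (q e x - lam) * (w.1.2.1 e x * w'.1.2.1 e x))) + ∑ v, α v * (w.1.1 v * w'.1.1 v) := by
  have h : ∀ e, ∫ x in Ioo 0 (Γ.L e), (w.1.2.2 e x * w'.1.2.2 e x +
        (q e x - lam) * (w.1.2.1 e x * w'.1.2.1 e x)) =
      ((∫ x in Ioo 0 (Γ.L e), w.1.2.2 e x * w'.1.2.2 e x) +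
        ∫ x in Ioo 0 (Γ.L e), q e x * (w.1.2.1 e x * w'.1.2.1 e x)) -
        lam * ∫ x in Ioo 0 (Γ.L e), 1 * (w.1.2.1 e x * w'.1.2.1 e x) := by
    intro e
    have h1 := sobolev_integrable_grad_mul w w' e
    have h2 := integrable_bounded_mul hq (sobolev_integrable_mul w w' e)
    have h3 := (integrable_bounded_mul Γ.memLp_one_top (sobolev_integrable_mul w w' e))
    have h12 : Integrable (fun x => w.1.2.2 e x * w'.1.2.2 e x +
      q e x * (w.1.2.1 e x * w'.1.2.1 e x)) (Γ.edgeMeasure e) := h1.add h2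
    rw [← integral_const_mul, ← integral_add h1 h2, ← integral_sub h12 (h3.const_mul lam)]
    refine integral_congr_ae (Eventually.of_forall fun x => ?_)
    ring
  simp only [h, Finset.sum_sub_distrib, Finset.sum_add_distrib, ← Finset.mul_sum]
  simp only [energyForm, normForm, LinearMap.sub_apply, LinearMap.add_apply, LinearMap.smul_apply,
    gradForm_apply, massForm_apply, vertexForm_apply, smul_eq_mul]
  ring

namespace IsSolution

variable {p : E → ℝ → ℝ} {c : V → ℝ} {f k : E → ℝ → ℝ}

theorem isH1 (h : Γ.IsSolution p c f k) (e : E) : IsH1 (Γ.L e) (f e) (k e) where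
  memLp := by
    obtain ⟨C, hC⟩ := isCompact_Icc.exists_bound_of_continuousOn (h.continuousOn_deriv e)
    have h1 : MemLp (k e) 2 (volume.restrict (Icc 0 (Γ.L e))) := by
      refine MemLp.of_bound ((h.continuousOn_deriv e).aestronglyMeasurable measurableSet_Icc) C ?_
      rw [ae_restrict_iff' measurableSet_Icc]
      exact Eventually.of_forall hC
    exact h1.mono_measure (Measure.restrict_mono_set _ Ioo_subset_Icc_self)
  eq := h.eq e

/-- A solution as an element of `H¹(Γ)`. -/
def toSobolev (h : Γ.IsSolution p c f k) : Γ.sobolev :=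
  ⟨(c, f, k), fun e => ⟨h.isH1 e, h.origin e, h.terminus e⟩⟩

theorem integrable_mul (h : Γ.IsSolution p c f k) (hp : ∀ e, MemLp (p e) ⊤ (Γ.edgeMeasure e))
    (e : E) : IntegrableOn (fun x => p e x * f e x) (Ioo 0 (Γ.L e)) :=
  integrable_bounded_mul hp (integrableOn_Ioo_of_continuousOn (h.continuousOn e))

/-- The first variation of the energy at a solution consists of vertex terms. -/
theorem energyForm_sub_apply {q : E → ℝ → ℝ} {hq : ∀ e, MemLp (q e) ⊤ (Γ.edgeMeasure e)}
    {lam : ℝ} (h : Γ.IsSolution (fun e x => q e x - lam) c f k) (α : V → ℝ) (w : Γ.sobolev) :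
    (Γ.energyForm q hq α - lam • Γ.normForm) h.toSobolev w =
      ∑ v, w.1.1 v * (α v * c v - ∑ p ∈ Γ.ends v, Γ.outward k p) := by
  rw [CompactMetricGraph.energyForm_sub_apply]
  -- Since `k' = (q - lam) f`, the integrand is the derivative of `k` times the test function.
  have h1 : ∀ e, ∫ x in Ioo 0 (Γ.L e), (h.toSobolev.1.2.2 e x * w.1.2.2 e x +
        (q e x - lam) * (h.toSobolev.1.2.1 e x * w.1.2.1 e x)) =
      k e (Γ.L e) * w.1.1 (Γ.t e) - k e 0 * w.1.1 (Γ.o e) := by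
    intro e
    rw [← (w.2 e).2.1, ← (w.2 e).2.2, ← integral_mul_add_mul_of_primitive (Γ.L_pos e).le
      (h.integrable_mul (memLp_sub_const hq lam) e) (h.deriv_eq e) (w.2 e).1.integrableOn
      ((w.2 e).1.eq)]
    refine integral_congr_ae (Eventually.of_forall fun x => ?_)
    simp only [toSobolev]
    ring
  simp only [h1, mul_sub, Finset.sum_sub_distrib]
  rw [← Finset.sum_sub_distrib, sum_edges_eq_sum_vertices, neg_add_eq_sub]
  congr 1
  exact Finset.sum_congr rfl fun v _ => by simp only [toSobolev]; ring

end IsSolution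

/-- Cauchy–Schwarz for a nonnegative symmetric form: a null vector lies in its radical. Minimisers
are thus critical points, without differentiating along a perturbation. -/
theorem form_eq_zero_of_self_eq_zero {q : E → ℝ → ℝ}
    {hq : ∀ e, MemLp (q e) ⊤ (Γ.edgeMeasure e)} {α : V → ℝ} {lam : ℝ}
    (hs : ∀ w, 0 ≤ (Γ.energyForm q hq α - lam • Γ.normForm) w w) {w : Γ.sobolev}
    (hw : (Γ.energyForm q hq α - lam • Γ.normForm) w w = 0) (w' : Γ.sobolev) :
    (Γ.energyForm q hq α - lam • Γ.normForm) w w' = 0 := by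
  have h1 := LinearMap.BilinForm.apply_sq_le_of_symm _ hs
    ⟨fun x y => by
      simp only [LinearMap.sub_apply, LinearMap.smul_apply, RingHom.id_apply]
      rw [energyForm_isSymm, normForm_isSymm]⟩ w w'
  rw [hw, zero_mul] at h1
  exact pow_eq_zero_iff two_ne_zero |>.1 (h1.antisymm (sq_nonneg _))

/-! ### Test functions and the Euler–Lagrange equations -/

/-- The function which vanishes outside the edge `e` and is a primitive of `v` on `e`. -/
theorem bump_mem_sobolev [DecidableEq E] {e : E} {v : ℝ → ℝ} (hv : MemLp v 2 (Γ.edgeMeasure e))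
    (h0 : ∫ x in Ioo 0 (Γ.L e), v x = 0) :
    ((0, Pi.single e fun x => ∫ s in (0 : ℝ)..x, v s, Pi.single e v) :
      (V → ℝ) × (E → ℝ → ℝ) × (E → ℝ → ℝ)) ∈ Γ.sobolev := by
  intro e'
  rcases eq_or_ne e' e with rfl | he
  · simp only [Pi.single_eq_same]
    refine ⟨⟨hv, fun x _ => by simp⟩, by simp, ?_⟩
    rw [← integral_Ioo_eq (Γ.L_pos e').le, h0]
    rfl
  · simp only [Pi.single_eq_of_ne he]
    exact ⟨IsH1.const _ 0, rfl, rfl⟩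

/-- The piecewise affine function with prescribed vertex values. -/
theorem affine_mem_sobolev (d : V → ℝ) :
    ((d, fun e x => d (Γ.o e) + x * ((d (Γ.t e) - d (Γ.o e)) / Γ.L e),
      fun e _ => (d (Γ.t e) - d (Γ.o e)) / Γ.L e) :
      (V → ℝ) × (E → ℝ → ℝ) × (E → ℝ → ℝ)) ∈ Γ.sobolev := by
  refine fun e => ⟨⟨memLp_const _, fun x _ => by simp; ring⟩, by simp, ?_⟩
  have := (Γ.L_pos e).ne'
  field_simp
  ring

/-- Euler–Lagrange: a minimizer solves the differential equation and satisfies the `δ` conditions. -/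
theorem exists_isSolution_of_minimizer {q : E → ℝ → ℝ}
    {hq : ∀ e, MemLp (q e) ⊤ (Γ.edgeMeasure e)} {α : V → ℝ} {lam : ℝ}
    (hs : ∀ w, 0 ≤ (Γ.energyForm q hq α - lam • Γ.normForm) w w) {w : Γ.sobolev}
    (hw : (Γ.energyForm q hq α - lam • Γ.normForm) w w = 0) :
    ∃ k, Γ.IsSolution (fun e x => q e x - lam) w.1.1 w.1.2.1 k ∧ Γ.Kirchhoff α w.1.1 k := by
  classical
  have hEL := form_eq_zero_of_self_eq_zero hs hw
  have hpf : ∀ e, IntegrableOn (fun x => (q e x - lam) * w.1.2.1 e x) (Ioo 0 (Γ.L e)) := fun e =>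
    integrable_bounded_mul (memLp_sub_const hq lam)
      (integrableOn_Ioo_of_continuousOn (w.2 e).1.continuousOn)
  let G : E → ℝ → ℝ := fun e x => ∫ s in (0 : ℝ)..x, (q e s - lam) * w.1.2.1 e s
  have hG0 : ∀ e, G e 0 = 0 := fun e => intervalIntegral.integral_same
  have hG : ∀ e, ∀ x ∈ Icc 0 (Γ.L e), G e x = G e 0 +
      ∫ s in (0 : ℝ)..x, (q e s - lam) * w.1.2.1 e s := fun e x _ => by rw [hG0, zero_add]
  have hGc : ∀ e, ContinuousOn (G e) (Icc 0 (Γ.L e)) := fun e =>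
    continuousOn_of_primitive (hpf e) (hG e)
  have hG2 : ∀ e, MemLp (G e) 2 (Γ.edgeMeasure e) := fun e => by
    obtain ⟨C, hC⟩ := isCompact_Icc.exists_bound_of_continuousOn (hGc e)
    refine MemLp.of_bound (((hGc e).mono Ioo_subset_Icc_self).aestronglyMeasurable
      measurableSet_Ioo) C ?_
    rw [ae_restrict_iff' measurableSet_Ioo]
    exact Eventually.of_forall fun x hx => hC x (Ioo_subset_Icc_self hx)
  -- The du Bois-Reymond argument: testing with the primitive of a mean-zero `v` and moving the
  -- potential term onto `G` by parts gives `∫ (f' - G) v = 0`, so `f' - G` is constant.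
  have hC : ∀ e, ∃ C : ℝ, (fun x => w.1.2.2 e x - G e x) =ᵐ[Γ.edgeMeasure e] fun _ => C := by
    intro e
    refine exists_ae_eq_const_of_orthogonal (Γ.L_pos e) ((w.2 e).1.memLp.sub (hG2 e))
      fun v hv hv0 => ?_
    have h1 := hEL ⟨_, bump_mem_sobolev hv hv0⟩
    rw [energyForm_sub_apply, Finset.sum_eq_single e] at h1
    · simp only [Pi.single_eq_same, Pi.zero_apply, mul_zero, Finset.sum_const_zero, add_zero] at h1
      have h2 := integral_mul_add_mul_of_primitive (Γ.L_pos e).le (hpf e) (hG e)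
        (φ := fun x => ∫ s in (0 : ℝ)..x, v s) (hv.integrable one_le_two) (fun x _ => by simp)
      rw [← integral_Ioo_eq (Γ.L_pos e).le, hv0, hG0, mul_zero, zero_mul, sub_zero] at h2
      have hφ : IsH1 (Γ.L e) (fun x => ∫ s in (0 : ℝ)..x, v s) v := ⟨hv, fun x _ => by simp⟩
      have i1 : IntegrableOn (fun x => w.1.2.2 e x * v x + (q e x - lam) * (w.1.2.1 e x *
          ∫ s in (0 : ℝ)..x, v s)) (Ioo 0 (Γ.L e)) :=
        ((w.2 e).1.memLp.integrable_mul hv).add (integrable_bounded_mul (memLp_sub_const hq lam)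
          (integrableOn_Ioo_of_continuousOn ((w.2 e).1.continuousOn.mul hφ.continuousOn)))
      have i2 : IntegrableOn (fun x => (q e x - lam) * w.1.2.1 e x * (∫ s in (0 : ℝ)..x, v s) +
          G e x * v x) (Ioo 0 (Γ.L e)) := by
        refine Integrable.add ?_ ((hG2 e).integrable_mul hv)
        refine (integrable_bounded_mul (memLp_sub_const hq lam)
          (integrableOn_Ioo_of_continuousOn ((w.2 e).1.continuousOn.mul hφ.continuousOn))).congr
          (Eventually.of_forall fun x => ?_)
        simp only [Pi.mul_apply]
        ring
      have h3 := integral_sub i1 i2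
      rw [h1, h2, sub_zero] at h3
      refine Eq.trans (integral_congr_ae (Eventually.of_forall fun x => ?_)) h3
      simp only
      ring
    · intro e' _ he
      simp only [Pi.single_eq_of_ne he, Pi.zero_apply, mul_zero, add_zero, integral_zero]
    · simp
  choose C hC using hC
  set k : E → ℝ → ℝ := fun e x => C e + G e x with hk
  have hkg : ∀ e, w.1.2.2 e =ᵐ[Γ.edgeMeasure e] k e := fun e => by
    filter_upwards [hC e] with x hx
    simp only [hk]
    linarith
  have hsol : Γ.IsSolution (fun e x => q e x - lam) w.1.1 w.1.2.1 k :=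
    { continuousOn := fun e => (w.2 e).1.continuousOn
      continuousOn_deriv := fun e => continuousOn_const.add (hGc e)
      eq := fun e x hx => by
        rw [(w.2 e).1.eq x hx]
        congr 1
        refine intervalIntegral.integral_congr_ae_restrict ?_
        rw [uIoc_of_le hx.1, ← Measure.restrict_congr_set Ioo_ae_eq_Ioc]
        exact ae_mono (Measure.restrict_mono_set volume (Ioo_subset_Ioo_right hx.2)) (hkg e)
      deriv_eq := fun e x hx => by
        simp only [hk, hG0, add_zero, G]
      origin := fun e => (w.2 e).2.1
      terminus := fun e => (w.2 e).2.2 }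
  refine ⟨k, hsol, fun v => ?_⟩
  -- With the differential equation known, only vertex terms are left; the piecewise affine function
  -- equal to `1` at `v` and `0` at the other vertices isolates the condition at `v`.
  have h1 := hEL ⟨_, affine_mem_sobolev (Pi.single v 1)⟩
  have h2 : ∀ w', (Γ.energyForm q hq α - lam • Γ.normForm) w w' =
      (Γ.energyForm q hq α - lam • Γ.normForm) hsol.toSobolev w' := by
    intro w'
    rw [energyForm_sub_apply, energyForm_sub_apply]
    congr 1
    refine Finset.sum_congr rfl fun e _ => integral_congr_ae ?_
    filter_upwards [hkg e] with x hx
    rw [hx]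
    rfl
  rw [h2, hsol.energyForm_sub_apply, Finset.sum_eq_single v] at h1
  · simp only [Pi.single_eq_same, one_mul] at h1
    linarith
  · intro v' _ hv
    simp only [Pi.single_eq_of_ne hv, zero_mul]
  · simp

/-- The first variation at a solution consists of vertex terms, each of which vanishes by the `δ`
condition. Thus every solution, not only a chosen minimiser, is a null vector; nonnegativity of the
form is not involved. -/
theorem IsSolution.form_self_eq_zero {q : E → ℝ → ℝ} {hq : ∀ e, MemLp (q e) ⊤ (Γ.edgeMeasure e)}
    {lam : ℝ} {c : V → ℝ} {f k : E → ℝ → ℝ} {α : V → ℝ}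
    (h : Γ.IsSolution (fun e x => q e x - lam) c f k) (hK : Γ.Kirchhoff α c k) :
    (Γ.energyForm q hq α - lam • Γ.normForm) h.toSobolev h.toSobolev = 0 := by
  rw [h.energyForm_sub_apply]
  exact Finset.sum_eq_zero fun v _ => by rw [hK v, sub_self, mul_zero]

/-- The absolute value of a minimizing solution is again a minimizing solution. -/
theorem IsSolution.exists_abs {q : E → ℝ → ℝ} {hq : ∀ e, MemLp (q e) ⊤ (Γ.edgeMeasure e)}
    {lam : ℝ} {c : V → ℝ} {f k : E → ℝ → ℝ} {α : V → ℝ}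
    (hs : ∀ w, 0 ≤ (Γ.energyForm q hq α - lam • Γ.normForm) w w)
    (h : Γ.IsSolution (fun e x => q e x - lam) c f k) (hK : Γ.Kirchhoff α c k) :
    ∃ k', Γ.IsSolution (fun e x => q e x - lam) (fun v => |c v|) (fun e x => |f e x|) k' ∧
      Γ.Kirchhoff α (fun v => |c v|) k' := by
  let w : Γ.sobolev := ⟨(fun v => |c v|, fun e x => |f e x|, fun e x => f e x / |f e x| * k e x),
    fun e => ⟨isH1_abs (h.continuousOn_deriv e) (h.eq e), congrArg abs (h.origin e),
      congrArg abs (h.terminus e)⟩⟩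
  -- Only the gradient term changes, by the factor `(f / |f|)² ≤ 1`; potential and vertex terms
  -- depend on squares alone.
  have h1 : (Γ.energyForm q hq α - lam • Γ.normForm) w w ≤ 0 := by
    rw [← h.form_self_eq_zero (hq := hq) hK, CompactMetricGraph.energyForm_sub_apply,
      CompactMetricGraph.energyForm_sub_apply]
    refine add_le_add (Finset.sum_le_sum fun e _ => ?_) (Finset.sum_le_sum fun v _ => ?_)
    · refine integral_mono
        ((sobolev_integrable_grad_mul w w e).add
          (integrable_bounded_mul (memLp_sub_const hq lam) (sobolev_integrable_mul w w e)))
        ((sobolev_integrable_grad_mul h.toSobolev h.toSobolev e).add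
          (integrable_bounded_mul (memLp_sub_const hq lam)
            (sobolev_integrable_mul h.toSobolev h.toSobolev e))) fun x => ?_
      simp only [w, toSobolev, abs_mul_abs_self]
      refine add_le_add ?_ le_rfl
      rw [mul_mul_mul_comm, div_mul_div_comm, abs_mul_abs_self]
      exact mul_le_of_le_one_left (mul_self_nonneg _) (div_self_le_one _)
    · simp only [w, toSobolev, abs_mul_abs_self]
      exact le_rfl
  exact exists_isSolution_of_minimizer hs (h1.antisymm (hs w))

/-! ### Gluing functions on the edges -/

section Glue

variable (Γ) {Y : Type*}

/-- The function on `Γ` with prescribed values at the vertices and on the edges. -/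
def glue (c : V → Y) (f : E → ℝ → Y) (ho : ∀ e, f e 0 = c (Γ.o e))
    (ht : ∀ e, f e (Γ.L e) = c (Γ.t e)) : Γ.Space → Y :=
  Quot.lift (Sum.elim c fun p => f p.1 p.2) (by
    rintro _ _ (e | e)
    · exact ho e
    · exact ht e)

variable {Γ} {c : V → Y} {f : E → ℝ → Y} (ho : ∀ e, f e 0 = c (Γ.o e))
  (ht : ∀ e, f e (Γ.L e) = c (Γ.t e))

theorem continuous_glue [TopologicalSpace Y] (hf : ∀ e, ContinuousOn (f e) (Icc 0 (Γ.L e))) :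
    Continuous (Γ.glue c f ho ht) := by
  let _ : TopologicalSpace V := ⊥
  have : DiscreteTopology V := ⟨rfl⟩
  refine continuous_quot_lift _ (Continuous.sumElim continuous_of_discreteTopology ?_)
  exact continuous_sigma fun e => continuousOn_iff_continuous_domRestrict.1 (hf e)

theorem glue_edgePoint (e : E) {x : ℝ} (hx : x ∈ Icc 0 (Γ.L e)) :
    Γ.glue c f ho ht (Γ.edgePoint e x) = f e x := by
  simp only [glue, edgePoint, Sum.elim_inr]
  rw [projIcc_of_mem _ hx]

theorem glue_vertex (v : V) : Γ.glue c f ho ht (Quot.mk _ (Sum.inl v)) = c v := rfl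

theorem glue_induction {P : Y → Prop} (hc : ∀ v, P (c v))
    (hf : ∀ e, ∀ x ∈ Icc 0 (Γ.L e), P (f e x)) (x : Γ.Space) : P (Γ.glue c f ho ht x) := by
  induction x using Quot.ind with
  | _ a =>
    rcases a with v | ⟨e, x⟩
    · exact hc v
    · exact hf e x x.2

end Glue

/-- On a connected metric graph, a property of vertices which is invariant along the edges holds at
all vertices or at none. -/
theorem iff_of_connected [ConnectedSpace Γ.Space] {χ : V → Prop}
    (h : ∀ e, χ (Γ.o e) ↔ χ (Γ.t e)) (v v' : V) : χ v ↔ χ v' := by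
  classical
  -- The truth value of `χ`, extended constantly along each edge, is a continuous map to `Bool`,
  -- hence constant.
  have hcont : Continuous (Γ.glue (fun v => decide (χ v)) (fun e _ => decide (χ (Γ.o e)))
      (fun _ => rfl) fun e => by simp only [h e]) :=
    continuous_glue _ _ fun e => continuousOn_const
  have := PreconnectedSpace.constant inferInstance hcont (x := Quot.mk _ (Sum.inl v))
    (y := Quot.mk _ (Sum.inl v'))
  rw [glue_vertex, glue_vertex] at this
  exact decide_eq_decide.1 this

/-- For an isolated `v` the property of being equal to `v` would be invariant along all edges, yet
fail at the origin of any edge. Without edges, a single vertex would be a counterexample. -/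
theorem exists_incident_edge [ConnectedSpace Γ.Space] [Nonempty E] (v : V) :
    ∃ e, Γ.o e = v ∨ Γ.t e = v := by
  by_contra! hv
  obtain ⟨e⟩ := ‹Nonempty E›
  exact (hv e).1 ((iff_of_connected (χ := fun v' => v' = v)
    (fun e => ⟨fun h => absurd h (hv e).1, fun h => absurd h (hv e).2⟩) v (Γ.o e)).1 rfl)

/-! ### Absence of zeros -/

theorem IsSolution.eq_zero_of_zero {p : E → ℝ → ℝ} (hp : ∀ e, MemLp (p e) ⊤ (Γ.edgeMeasure e))
    {c : V → ℝ} {f k : E → ℝ → ℝ} (h : Γ.IsSolution p c f k) {e : E} {x : ℝ}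
    (hx : x ∈ Icc 0 (Γ.L e)) (hf : f e x = 0) (hk : k e x = 0) :
    ∀ y ∈ Icc 0 (Γ.L e), f e y = 0 := by
  have h0 : (0 : ℝ) ∈ Icc 0 (Γ.L e) := left_mem_Icc.2 (Γ.L_pos e).le
  refine eq_zero_of_initial_values (hp e) (h.continuousOn e) (h.continuousOn_deriv e)
    (fun x hx y hy => (h.isH1 e).sub_eq hx hy) (fun x hx y hy => ?_) hx hf hk
  have hi := h.integrable_mul hp e
  rw [h.deriv_eq e x hx, h.deriv_eq e y hy, add_sub_add_left_eq_sub]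
  exact intervalIntegral.integral_interval_sub_left
    (intervalIntegrable_of_integrableOn hi h0 hy) (intervalIntegrable_of_integrableOn hi h0 hx)

/-- If a nonnegative solution with `δ` conditions vanishes at a vertex, it vanishes identically. -/
theorem IsSolution.eq_zero_of_nonneg_of_vertex [ConnectedSpace Γ.Space] {p : E → ℝ → ℝ}
    (hp : ∀ e, MemLp (p e) ⊤ (Γ.edgeMeasure e)) {c : V → ℝ} {f k : E → ℝ → ℝ} {α : V → ℝ}
    (h : Γ.IsSolution p c f k) (hK : Γ.Kirchhoff α c k)
    (hf : ∀ e, ∀ x ∈ Icc 0 (Γ.L e), 0 ≤ f e x) {v : V} (hv : c v = 0) :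
    ∀ e, ∀ x ∈ Icc 0 (Γ.L e), f e x = 0 := by
  have h0 : ∀ e, (0 : ℝ) ∈ Icc 0 (Γ.L e) := fun e => left_mem_Icc.2 (Γ.L_pos e).le
  have hL : ∀ e, Γ.L e ∈ Icc 0 (Γ.L e) := fun e => right_mem_Icc.2 (Γ.L_pos e).le
  -- At a zero of a nonnegative function the outward derivatives are nonnegative, and by the `δ`
  -- condition their sum is `α v * 0`; hence each vanishes.
  have hout : ∀ v, c v = 0 → ∀ p ∈ Γ.ends v, Γ.outward k p = 0 := by
    intro v hv
    have hsum := hK v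
    rw [hv, mul_zero] at hsum
    refine (Finset.sum_eq_zero_iff_of_nonneg ?_).1 hsum
    rintro ⟨e, b⟩ hb
    rw [mem_ends] at hb
    cases b
    · simp only [Bool.false_eq_true, if_false] at hb
      have := mul_deriv_nonneg_of_zero (h.continuousOn_deriv e) (h.eq e) (hf e) (h0 e) (hL e)
        (by rw [h.origin, hb, hv])
      rw [sub_zero] at this
      simpa [outward] using nonneg_of_mul_nonneg_right this (Γ.L_pos e)
    · simp only [if_true] at hb
      have := mul_deriv_nonneg_of_zero (h.continuousOn_deriv e) (h.eq e) (hf e) (hL e) (h0 e)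
        (by rw [h.terminus, hb, hv])
      rw [zero_sub, neg_mul, ← mul_neg] at this
      simpa [outward] using nonneg_of_mul_nonneg_right this (Γ.L_pos e)
  have hedge : ∀ e, c (Γ.o e) = 0 ∨ c (Γ.t e) = 0 → ∀ x ∈ Icc 0 (Γ.L e), f e x = 0 := by
    rintro e (he | he)
    · have := hout _ he (e, false) (by simp [mem_ends])
      exact h.eq_zero_of_zero hp (h0 e) (by rw [h.origin, he]) (by simpa [outward] using this)
    · have := hout _ he (e, true) (by simp [mem_ends])
      exact h.eq_zero_of_zero hp (hL e) (by rw [h.terminus, he]) (by simpa [outward] using this)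
  intro e
  refine hedge e (Or.inl ?_)
  -- Zeros propagate across each edge in both directions, so the set of vertex zeros is everything
  -- by connectedness.
  refine (iff_of_connected (Γ := Γ) (χ := fun v => c v = 0) (fun e => ⟨fun he => ?_, fun he => ?_⟩)
    v (Γ.o e)).1 hv
  · rw [← h.terminus]
    exact hedge e (Or.inl he) _ (hL e)
  · rw [← h.origin]
    exact hedge e (Or.inr he) _ (h0 e)

/-- If a nonnegative solution with `δ` conditions has a zero, it vanishes identically. -/
theorem IsSolution.eq_zero_of_nonneg [ConnectedSpace Γ.Space] {p : E → ℝ → ℝ}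
    (hp : ∀ e, MemLp (p e) ⊤ (Γ.edgeMeasure e)) {c : V → ℝ} {f k : E → ℝ → ℝ} {α : V → ℝ}
    (h : Γ.IsSolution p c f k) (hK : Γ.Kirchhoff α c k)
    (hf : ∀ e, ∀ x ∈ Icc 0 (Γ.L e), 0 ≤ f e x) {e : E} {x : ℝ} (hx : x ∈ Icc 0 (Γ.L e))
    (hfx : f e x = 0) : ∀ e, ∀ x ∈ Icc 0 (Γ.L e), f e x = 0 := by
  have h0 : (0 : ℝ) ∈ Icc 0 (Γ.L e) := left_mem_Icc.2 (Γ.L_pos e).le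
  have hL : Γ.L e ∈ Icc 0 (Γ.L e) := right_mem_Icc.2 (Γ.L_pos e).le
  rcases hx.1.eq_or_lt with rfl | hx0
  · exact h.eq_zero_of_nonneg_of_vertex hp hK hf (v := Γ.o e) (by rw [← h.origin, hfx])
  rcases hx.2.eq_or_lt with rfl | hxL
  · exact h.eq_zero_of_nonneg_of_vertex hp hK hf (v := Γ.t e) (by rw [← h.terminus, hfx])
  have h1 := mul_deriv_nonneg_of_zero (h.continuousOn_deriv e) (h.eq e) (hf e) hx h0 hfx
  have h2 := mul_deriv_nonneg_of_zero (h.continuousOn_deriv e) (h.eq e) (hf e) hx hL hfx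
  -- The derivative inequality towards both end points of the edge leaves only zero at an interior
  -- point.
  have hk : k e x = 0 := by
    rw [zero_sub, neg_mul, ← mul_neg] at h1
    have h3 := nonneg_of_mul_nonneg_right h1 hx0
    have h4 := nonneg_of_mul_nonneg_right h2 (sub_pos.2 hxL)
    linarith
  have := h.eq_zero_of_zero hp hx hfx hk 0 h0
  exact h.eq_zero_of_nonneg_of_vertex hp hK hf (v := Γ.o e) (by rw [← h.origin, this])

/-! ### Eigenvectors and solutions -/

theorem mem_eigenspace_schrodinger_iff {q : E → ℝ → ℝ} {α : V → ℝ} {μ : ℂ} {u : Γ.L2} :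
    u ∈ eigenspace (Γ.schrodinger q α) μ ↔ (u, μ • u) ∈ Γ.schrodingerGraph q α := by
  rw [← schrodinger_graph]
  rfl

/-- Eigenvectors are represented by continuous functions all of whose real parts (with respect to a
real functional on `ℂ`) are solutions with `δ` conditions. -/
theorem exists_isSolution_of_mem_eigenspace (hΓ : ∀ v, ∃ e, Γ.o e = v ∨ Γ.t e = v)
    {q : E → ℝ → ℝ} {α : V → ℝ} {μ : ℝ} {u : Γ.L2}
    (hu : u ∈ eigenspace (Γ.schrodinger q α) μ) :
    ∃ (c : V → ℂ) (f k : E → ℝ → ℂ),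
      (∀ e, (u e : ℝ → ℂ) =ᵐ[Γ.edgeMeasure e] f e) ∧
      (∀ e, ContinuousOn (f e) (Icc 0 (Γ.L e))) ∧ (∀ e, f e 0 = c (Γ.o e)) ∧
      ∀ ρ : ℂ →L[ℝ] ℝ,
        Γ.IsSolution (fun e x => q e x - μ) (fun v => ρ (c v)) (fun e x => ρ (f e x))
          (fun e x => ρ (k e x)) ∧ Γ.Kirchhoff α (fun v => ρ (c v)) (fun e x => ρ (k e x)) := by
  obtain ⟨f, f', f'', ⟨hH2, hδ⟩, huf, huw⟩ := mem_eigenspace_schrodinger_iff.1 hu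
  -- The value at a vertex is read off at an arbitrarily chosen incident edge end; the continuity
  -- part of the `δ` condition makes the choice irrelevant.
  have hends : ∀ v, ∃ p, p ∈ Γ.ends v := fun v => by
    obtain ⟨e, he | he⟩ := hΓ v
    · exact ⟨(e, false), by simpa [mem_ends] using he⟩
    · exact ⟨(e, true), by simpa [mem_ends] using he⟩
  choose p hp using hends
  have ho : ∀ e, f e 0 = Γ.boundaryValue f (p (Γ.o e)) := fun e =>
    (hδ (Γ.o e)).1 (e, false) (by simp [mem_ends]) _ (hp _)
  have ht : ∀ e, f e (Γ.L e) = Γ.boundaryValue f (p (Γ.t e)) := fun e =>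
    (hδ (Γ.t e)).1 (e, true) (by simp [mem_ends]) _ (hp _)
  have hf'' : ∀ e, f'' e =ᵐ[Γ.edgeMeasure e] fun x => (q e x - μ : ℝ) • f e x := by
    intro e
    have h1 := Lp.coeFn_smul (μ : ℂ) (u e)
    filter_upwards [huf e, huw e, h1] with x h2 h3 h4
    have h5 := h3.symm.trans h4
    simp only [Pi.smul_apply, smul_eq_mul] at h5 h2
    rw [h2] at h5
    rw [Complex.real_smul]
    push_cast
    linear_combination -h5
  refine ⟨fun v => Γ.boundaryValue f (p v), f, f', huf, fun e => (hH2 e).continuousOn, ho,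
    fun ρ => ⟨?_, fun v => ?_⟩⟩
  · exact
    { continuousOn := fun e => ρ.continuous.comp_continuousOn (hH2 e).continuousOn
      continuousOn_deriv := fun e => ρ.continuous.comp_continuousOn (hH2 e).continuousOn_deriv
      eq := fun e x hx => by
        rw [(hH2 e).eq x hx, map_add,
          ← ρ.intervalIntegral_comp_comm ((hH2 e).intervalIntegrable_fst hx)]
      deriv_eq := fun e x hx => by
        rw [(hH2 e).deriv_eq x hx, map_add,
          ← ρ.intervalIntegral_comp_comm ((hH2 e).intervalIntegrable_snd hx)]
        congr 1
        refine intervalIntegral.integral_congr_ae_restrict ?_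
        rw [uIoc_of_le hx.1, ← Measure.restrict_congr_set Ioo_ae_eq_Ioc]
        filter_upwards [ae_mono (Measure.restrict_mono_set volume (Ioo_subset_Ioo_right hx.2))
          (hf'' e)] with s hs
        rw [hs, map_smul, smul_eq_mul]
      origin := fun e => congrArg ρ (ho e)
      terminus := fun e => congrArg ρ (ht e) }
  · have h1 := congrArg ρ ((hδ v).2 (p v) (hp v))
    rw [map_sum, ← Complex.real_smul, map_smul, smul_eq_mul] at h1
    rw [← h1]
    refine Finset.sum_congr rfl fun p' _ => ?_
    simp only [outward, outwardDerivative]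
    split_ifs <;> simp

/-- A solution with `δ` conditions represents an eigenvector. -/
theorem IsSolution.exists_mem_eigenspace {q : E → ℝ → ℝ}
    (hq : ∀ e, MemLp (q e) ⊤ (Γ.edgeMeasure e)) {lam : ℝ} {c : V → ℝ} {f k : E → ℝ → ℝ}
    {α : V → ℝ} (h : Γ.IsSolution (fun e x => q e x - lam) c f k) (hK : Γ.Kirchhoff α c k) :
    ∃ u ∈ eigenspace (Γ.schrodinger q α) lam,
      ∀ e, (u e : ℝ → ℂ) =ᵐ[Γ.edgeMeasure e] fun x => (f e x : ℂ) := by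
  have hf : ∀ e, MemLp (f e) ⊤ (Γ.edgeMeasure e) := fun e => by
    obtain ⟨C, hC⟩ := isCompact_Icc.exists_bound_of_continuousOn (h.continuousOn e)
    refine memLp_top_of_bound (((h.continuousOn e).mono Ioo_subset_Icc_self).aestronglyMeasurable
      measurableSet_Ioo) C ?_
    rw [ae_restrict_iff' measurableSet_Ioo]
    exact Eventually.of_forall fun x hx => hC x (Ioo_subset_Icc_self hx)
  have hpf : ∀ e, MemLp (fun x => (q e x - lam) * f e x) ⊤ (Γ.edgeMeasure e) := fun e =>
    (hf e).mul (memLp_sub_const hq lam e)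
  have hfC : ∀ e, MemLp (fun x => (f e x : ℂ)) 2 (Γ.edgeMeasure e) := fun e =>
    ((hf e).mono_exponent le_top).ofReal
  let u : Γ.L2 := WithLp.toLp 2 fun e => (hfC e).toLp
  have hu : ∀ e, (u e : ℝ → ℂ) =ᵐ[Γ.edgeMeasure e] fun x => (f e x : ℂ) := fun e =>
    (hfC e).coeFn_toLp
  have hb : ∀ v, ∀ p ∈ Γ.ends v, Γ.boundaryValue (fun e x => (f e x : ℂ)) p = c v := by
    rintro v ⟨e, b⟩ hp
    rw [mem_ends] at hp
    cases b
    · simp only [Bool.false_eq_true, if_false] at hp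
      simp [boundaryValue, h.origin, hp]
    · simp only [if_true] at hp
      simp [boundaryValue, h.terminus, hp]
  refine ⟨u, mem_eigenspace_schrodinger_iff.2 ⟨fun e x => f e x, fun e x => k e x,
    fun e x => ((q e x - lam) * f e x : ℝ), ⟨fun e => ⟨?_, fun x hx => ?_, fun x hx => ?_⟩,
    fun v => ⟨fun p hp p' hp' => ?_, fun p hp => ?_⟩⟩, hu, fun e => ?_⟩, hu⟩
  · exact ((hpf e).mono_exponent le_top).ofReal
  · rw [intervalIntegral.integral_ofReal]
    exact (congrArg Complex.ofReal (h.deriv_eq e x hx)).trans (Complex.ofReal_add _ _)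
  · rw [intervalIntegral.integral_ofReal]
    exact (congrArg Complex.ofReal (h.eq e x hx)).trans (Complex.ofReal_add _ _)
  · rw [hb v p hp, hb v p' hp']
  · rw [hb v p hp, ← Complex.ofReal_mul, ← hK v, Complex.ofReal_sum]
    refine Finset.sum_congr rfl fun p' _ => ?_
    simp only [outward, outwardDerivative]
    split_ifs <;> simp
  · filter_upwards [hu e, Lp.coeFn_smul (lam : ℂ) (u e)] with x h1 h2
    refine h2.trans ?_
    simp only [Pi.smul_apply, smul_eq_mul]
    rw [h1]
    push_cast
    ring

theorem L2_eq_zero {u : Γ.L2} {f : E → ℝ → ℂ} (hu : ∀ e, (u e : ℝ → ℂ) =ᵐ[Γ.edgeMeasure e] f e)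
    (hf : ∀ e, ∀ x ∈ Icc 0 (Γ.L e), f e x = 0) : u = 0 := by
  ext1 e
  refine Lp.ext ?_
  filter_upwards [hu e, Lp.coeFn_zero ℂ 2 (Γ.edgeMeasure e),
    ae_restrict_mem measurableSet_Ioo] with x h1 h2 h3
  rw [h1, hf e x (Ioo_subset_Icc_self h3)]
  exact h2.symm

theorem eq_zero_of_normForm_eq_zero {w : Γ.sobolev} (h : Γ.normForm w w ≤ 0) (e : E) {x : ℝ}
    (hx : x ∈ Icc 0 (Γ.L e)) : w.1.2.1 e x = 0 := by
  have h1 : ∫ x in Ioo 0 (Γ.L e), w.1.2.1 e x ^ 2 = 0 :=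
    ((integral_sq_le_normForm w e).trans h).antisymm (integral_nonneg fun x => sq_nonneg _)
  rw [integral_eq_zero_iff_of_nonneg (fun x => sq_nonneg _) (w.2 e).1.sq_integrableOn,
    Measure.restrict_congr_set Ioo_ae_eq_Icc] at h1
  have h2 : w.1.2.1 e =ᵐ[volume.restrict (Icc 0 (Γ.L e))] fun _ => (0 : ℝ) := by
    filter_upwards [h1] with y hy
    simpa using hy
  exact Measure.eqOn_Icc_of_ae_eq volume (Γ.L_pos e).ne h2 (w.2 e).1.continuousOn
    continuousOn_const hx

/-- No eigenvalue lies below the minimum of the Rayleigh quotient. -/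
theorem le_of_eigenspace_ne_bot (hΓ : ∀ v, ∃ e, Γ.o e = v ∨ Γ.t e = v) {q : E → ℝ → ℝ}
    {hq : ∀ e, MemLp (q e) ⊤ (Γ.edgeMeasure e)} {α : V → ℝ} {lam μ : ℝ}
    (hs : ∀ w, 0 ≤ (Γ.energyForm q hq α - lam • Γ.normForm) w w)
    (hμ : eigenspace (Γ.schrodinger q α) μ ≠ ⊥) : lam ≤ μ := by
  obtain ⟨u, hu, hu0⟩ := Submodule.exists_mem_ne_zero_of_ne_bot hμ
  obtain ⟨c, f, k, huf, -, -, hsol⟩ := exists_isSolution_of_mem_eigenspace hΓ hu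
  by_contra! hlt
  -- At level `μ` the solution has `A = μ * N`, while `A ≥ lam * N`; so `μ < lam` forces `N ≤ 0`.
  have key : ∀ ρ : ℂ →L[ℝ] ℝ, ∀ e, ∀ x ∈ Icc 0 (Γ.L e), ρ (f e x) = 0 := by
    intro ρ e x hx
    have h1 := (hsol ρ).1.form_self_eq_zero (hq := hq) (hsol ρ).2
    have h2 := hs (hsol ρ).1.toSobolev
    simp only [LinearMap.sub_apply, LinearMap.smul_apply, smul_eq_mul] at h1 h2
    refine eq_zero_of_normForm_eq_zero (w := (hsol ρ).1.toSobolev) ?_ e hx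
    nlinarith
  refine hu0 (L2_eq_zero huf fun e x hx => Complex.ext ?_ ?_)
  · exact key Complex.reCLM e x hx
  · exact key Complex.imCLM e x hx

/-! ### Rigidity at the lowest eigenvalue -/

/-- A minimizing solution which vanishes at a vertex vanishes identically. -/
theorem IsSolution.eq_zero_of_vertex [ConnectedSpace Γ.Space] {q : E → ℝ → ℝ}
    {hq : ∀ e, MemLp (q e) ⊤ (Γ.edgeMeasure e)} {lam : ℝ} {c : V → ℝ} {f k : E → ℝ → ℝ}
    {α : V → ℝ} (hs : ∀ w, 0 ≤ (Γ.energyForm q hq α - lam • Γ.normForm) w w)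
    (h : Γ.IsSolution (fun e x => q e x - lam) c f k) (hK : Γ.Kirchhoff α c k) {v : V}
    (hv : c v = 0) : ∀ e, ∀ x ∈ Icc 0 (Γ.L e), f e x = 0 := by
  -- The sign of `f` is unknown, so the argument for nonnegative solutions is applied to `|f|`.
  obtain ⟨k', h', hK'⟩ := h.exists_abs hs hK
  intro e x hx
  exact abs_eq_zero.1 (h'.eq_zero_of_nonneg_of_vertex (memLp_sub_const hq lam) hK'
    (fun _ _ _ => abs_nonneg _) (v := v) (by rw [hv, abs_zero]) e x hx)

/-- An eigenvector of the lowest eigenvalue whose continuous representative vanishes at a vertex is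
zero. -/
theorem eq_zero_of_mem_eigenspace_of_vertex [Nonempty E] [ConnectedSpace Γ.Space] {q : E → ℝ → ℝ}
    {hq : ∀ e, MemLp (q e) ⊤ (Γ.edgeMeasure e)} {α : V → ℝ} {lam : ℝ}
    (hs : ∀ w, 0 ≤ (Γ.energyForm q hq α - lam • Γ.normForm) w w) {u : Γ.L2}
    (hu : u ∈ eigenspace (Γ.schrodinger q α) lam) {e₀ : E} {g : ℝ → ℂ}
    (hg : ContinuousOn g (Icc 0 (Γ.L e₀))) (hug : (u e₀ : ℝ → ℂ) =ᵐ[Γ.edgeMeasure e₀] g)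
    (hg0 : g 0 = 0) : u = 0 := by
  obtain ⟨c, f, k, huf, hfc, ho, hsol⟩ :=
    exists_isSolution_of_mem_eigenspace exists_incident_edge hu
  have h1 : EqOn (f e₀) g (Icc 0 (Γ.L e₀)) := by
    refine Measure.eqOn_Icc_of_ae_eq volume (Γ.L_pos e₀).ne ?_ (hfc e₀) hg
    rw [← Measure.restrict_congr_set Ioo_ae_eq_Icc]
    exact (huf e₀).symm.trans hug
  have h2 : c (Γ.o e₀) = 0 := by
    rw [← ho, h1 (left_mem_Icc.2 (Γ.L_pos e₀).le), hg0]
  have key : ∀ ρ : ℂ →L[ℝ] ℝ, ∀ e, ∀ x ∈ Icc 0 (Γ.L e), ρ (f e x) = 0 := fun ρ =>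
    (hsol ρ).1.eq_zero_of_vertex hs (hsol ρ).2 (v := Γ.o e₀) (by rw [h2, map_zero])
  refine L2_eq_zero huf fun e x hx => Complex.ext ?_ ?_
  · exact key Complex.reCLM e x hx
  · exact key Complex.imCLM e x hx

/-- The minimum of the Rayleigh quotient is attained at a strictly positive solution. -/
theorem exists_pos_isSolution [Nonempty E] [ConnectedSpace Γ.Space] {q : E → ℝ → ℝ}
    {hq : ∀ e, MemLp (q e) ⊤ (Γ.edgeMeasure e)} {α : V → ℝ} {lam : ℝ}
    (hs : ∀ w, 0 ≤ (Γ.energyForm q hq α - lam • Γ.normForm) w w) {w : Γ.sobolev}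
    (hw : (Γ.energyForm q hq α - lam • Γ.normForm) w w = 0) (hw0 : 0 < Γ.normForm w w) :
    ∃ c f k, Γ.IsSolution (fun e x => q e x - lam) c f k ∧ Γ.Kirchhoff α c k ∧
      (∀ v, 0 < c v) ∧ ∀ e, ∀ x ∈ Icc 0 (Γ.L e), 0 < f e x := by
  obtain ⟨k, h, hK⟩ := exists_isSolution_of_minimizer hs hw
  obtain ⟨k', h', hK'⟩ := h.exists_abs hs hK
  have hp := memLp_sub_const hq lam
  have h0 : ∀ e, ∀ x ∈ Icc 0 (Γ.L e), 0 ≤ |w.1.2.1 e x| := fun _ _ _ => abs_nonneg _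
  have hne : ¬∀ e, ∀ x ∈ Icc 0 (Γ.L e), |w.1.2.1 e x| = 0 := fun hz => by
    refine hw0.ne' ?_
    rw [normForm_self]
    refine Finset.sum_eq_zero fun e _ => ?_
    refine (setIntegral_congr_fun (g := fun _ => 0) measurableSet_Ioo fun x hx => ?_).trans (by simp)
    simp [abs_eq_zero.1 (hz e x (Ioo_subset_Icc_self hx))]
  refine ⟨_, _, k', h', hK', fun v => ?_, fun e x hx => ?_⟩
  · exact (abs_nonneg _).lt_of_ne' fun hv =>
      hne (h'.eq_zero_of_nonneg_of_vertex hp hK' h0 hv)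
  · exact (abs_nonneg _).lt_of_ne' fun hv => hne (h'.eq_zero_of_nonneg hp hK' h0 hx hv)

end CompactMetricGraph

end QuantumGraph

open QuantumGraph QuantumGraph.CompactMetricGraph

/-- On a connected compact metric graph with `δ` coupling conditions at all vertices and a real
potential in `L^∞`, the Schrödinger operator has a lowest eigenvalue, this eigenvalue is simple, all
its eigenfunctions are free of zeros, and one of them is strictly positive. -/
theorem mainTheorem4 {V E : Type*} [Fintype V] [Fintype E] [Nonempty E]
    (Γ : QuantumGraph.CompactMetricGraph V E) [ConnectedSpace Γ.Space]
    (q : E → ℝ → ℝ) (hq : ∀ e, MemLp (q e) ⊤ (Γ.edgeMeasure e)) (α : V → ℝ) :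
    ∃ lam : ℝ,
      IsLeast {μ : ℝ | QuantumGraph.eigenspace (Γ.schrodinger q α) μ ≠ ⊥} lam ∧
      Module.finrank ℂ (QuantumGraph.eigenspace (Γ.schrodinger q α) lam) = 1 ∧
      (∀ u ∈ QuantumGraph.eigenspace (Γ.schrodinger q α) lam, u ≠ 0 →
        ∃ F : Γ.Space → ℂ, Continuous F ∧ Γ.Represents F u ∧ ∀ x, F x ≠ 0) ∧
      ∃ u ∈ QuantumGraph.eigenspace (Γ.schrodinger q α) lam, u ≠ 0 ∧
        ∃ F : Γ.Space → ℝ, Continuous F ∧ Γ.Represents (fun x => (F x : ℂ)) u ∧ ∀ x, 0 < F x := by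
  obtain ⟨lam, hs, w, hw, hw0⟩ := exists_minimizer exists_incident_edge q hq α
  obtain ⟨c, f, k, hsol, hK, hc0, hf0⟩ := exists_pos_isSolution hs hw hw0
  obtain ⟨u₀, hu₀, hu₀f⟩ := hsol.exists_mem_eigenspace hq hK
  obtain ⟨e₀⟩ := ‹Nonempty E›
  have hne : Nonempty E := ⟨e₀⟩
  have h00 : (0 : ℝ) ∈ Icc 0 (Γ.L e₀) := left_mem_Icc.2 (Γ.L_pos e₀).le
  let F := Γ.glue c f hsol.origin hsol.terminus
  have hF : Continuous F := continuous_glue _ _ hsol.continuousOn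
  have hFpos : ∀ x, 0 < F x := glue_induction _ _ hc0 hf0
  have hFr : Γ.Represents (fun x => (F x : ℂ)) u₀ := by
    intro e
    filter_upwards [hu₀f e, ae_restrict_mem measurableSet_Ioo] with x h1 h2
    rw [h1]
    simp only [F]
    rw [glue_edgePoint _ _ e (Ioo_subset_Icc_self h2)]
  have hu₀0 : u₀ ≠ 0 := by
    rintro rfl
    have h1 : EqOn (fun x => (f e₀ x : ℂ)) (fun _ => 0) (Icc 0 (Γ.L e₀)) := by
      refine Measure.eqOn_Icc_of_ae_eq volume (Γ.L_pos e₀).ne ?_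
        (Complex.continuous_ofReal.comp_continuousOn (hsol.continuousOn e₀)) continuousOn_const
      rw [← Measure.restrict_congr_set Ioo_ae_eq_Icc]
      exact (hu₀f e₀).symm.trans (Lp.coeFn_zero ℂ 2 (Γ.edgeMeasure e₀))
    exact (hf0 e₀ 0 h00).ne' (Complex.ofReal_eq_zero.1 (h1 h00))
  have hspan : ∀ u ∈ eigenspace (Γ.schrodinger q α) lam, ∃ z : ℂ, z • u₀ = u := by
    intro u hu
    obtain ⟨d, g, k', hug, hgc, -, -⟩ :=
      exists_isSolution_of_mem_eigenspace exists_incident_edge hu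
    have hf00 : (f e₀ 0 : ℂ) ≠ 0 := Complex.ofReal_ne_zero.2 (hf0 e₀ 0 h00).ne'
    -- Chosen so that `u - z • u₀` vanishes at the origin of `e₀`; it is then zero.
    set z : ℂ := g e₀ 0 / f e₀ 0 with hz
    refine ⟨z, (sub_eq_zero.1 (eq_zero_of_mem_eigenspace_of_vertex hs (e₀ := e₀)
      (g := fun x => g e₀ x - z * f e₀ x)
      (Submodule.sub_mem _ hu (Submodule.smul_mem _ z hu₀)) ?_ ?_ ?_)).symm⟩
    · exact (hgc e₀).sub (continuousOn_const.mul
        (Complex.continuous_ofReal.comp_continuousOn (hsol.continuousOn e₀)))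
    · filter_upwards [Lp.coeFn_sub (u e₀) (z • u₀ e₀), Lp.coeFn_smul z (u₀ e₀), hug e₀,
        hu₀f e₀] with x h1 h2 h3 h4
      refine h1.trans ?_
      rw [Pi.sub_apply, h2, Pi.smul_apply, h3, h4, smul_eq_mul]
    · simp only [hz]
      rw [div_mul_cancel₀ _ hf00, sub_self]
  refine ⟨lam, ⟨?_, fun μ hμ => le_of_eigenspace_ne_bot exists_incident_edge hs hμ⟩, ?_, ?_, ?_⟩
  · exact fun h => hu₀0 ((Submodule.eq_bot_iff _).1 h u₀ hu₀)
  · refine finrank_eq_one ⟨u₀, hu₀⟩ (fun h => hu₀0 (congrArg Subtype.val h)) ?_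
    rintro ⟨u, hu⟩
    obtain ⟨z, hz⟩ := hspan u hu
    exact ⟨z, Subtype.ext hz⟩
  · intro u hu hu0
    obtain ⟨z, rfl⟩ := hspan u hu
    have hz : z ≠ 0 := fun h => hu0 (by rw [h, zero_smul])
    refine ⟨fun x => z * F x, continuous_const.mul (Complex.continuous_ofReal.comp hF),
      fun e => ?_, fun x => mul_ne_zero hz (Complex.ofReal_ne_zero.2 (hFpos x).ne')⟩
    filter_upwards [Lp.coeFn_smul z (u₀ e), hFr e] with x h1 h2
    refine h1.trans ?_
    rw [Pi.smul_apply, h2, smul_eq_mul]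
  · exact ⟨u₀, hu₀, hu₀0, F, hF, hFr, hFpos⟩
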